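/- Let $m,n\ge 0$, $f:\{0,1\}^n\to\mathbb R$, $H=(h_1,\dots,h_m):\{0,1\}^n\to\mathbb R^m$, and $L(x,\lambda)=f(x)+\lambda^{T}H(x)$. For nonempty $X\subseteq\{0,1\}^n$ let $g_X(\lambda)=\min_{x\in X}L(x,\lambda)$, and let $g=g_{\{0,1\}^n}$. Let $S=\prod_{i=1}^m[N_i,M_i]$ with $N_i<M_i$ be the search box, let $$\chi_g=\bigcup_{\lambda\in S}\operatorname*{argmin}_{x\in\{0,1\}^n}L(x,\lambda),$$ and let $\mathcal O$ be an oracle, i.e. a function assigning to each $\lambda\in S$ some element of $\operatorname{argmin}_x L(x,\lambda)$. Write points of $\mathbb R^{m+1}$ as $v=(\lambda_v,z_v)$, put $P_x=\{(\lambda,z): z=L(x,\lambda)\}$, $P_x(\lambda)=L(x,\lambda)$, and $\Gamma_X=\{(\lambda,z):\lambda\in S,\ z\le g_X(\lambda)\}$. The algorithm DualSearch maintains a set $X\subseteq\{0,1\}^n$, an ordered list $\mathcal V$ of points of $\mathbb R^{m+1}$ and a set $\mathcal E$ of segments and downward vertical rays. *Initialization.* For an arbitrary corner $\lambda_0$ of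 $S$ put $x_0=\mathcal O(\lambda_0)$ and $X=\{x_0\}$; $\mathcal V$ consists of the points $(\lambda,P_{x_0}(\lambda))$ with $\lambda$ a corner of $S$, in arbitrary order; $\mathcal E$ consists of the edges of $\Gamma_X$ (the bounded ones, and the vertical rays below its vertices over the corners of $S$). *Loop.* For each $v\in\mathcal V$, in the order of the list, put $x_v=\mathcal O(\lambda_v)$. If $P_{x_v}(\lambda_v)<z_v$, then: add $x_v$ to $X$; append to $\mathcal V$, in arbitrary order, the points of $\mathcal V^+=\{u\in P_{x_v}\cap e: e\in\mathcal E,\ e\not\subseteq P_{x_v}\}$ that are not yet in it; remove $\mathcal V^-=\{u\in\mathcal V: z_u>P_{x_v}(\lambda_u)\}$ from $\mathcal V$; and replace $\mathcal E$ by $(\mathcal E\cup \mathrm{ConvEdge}(\mathcal V^+)\cup\mathcal E^+)\setminus\mathcal E^-$. Here $\mathrm{ConvEdge}(\mathcal V^+)$ is the set of edges of the convex hull of $\mathcal V^+$, $\mathcal E^-$ is the set of edges in $\mathcal E$ with an endpoint in $\mathcal V^-$, and $\mathcal E^+$ consists of the parts, cut off at the point where the edge meets $P_{x_v}$, of those edges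 in $\mathcal E^-$ that meet $P_{x_v}$ and whose other endpoint (possibly at $-\infty$) is not in $\mathcal V^-$. The algorithm terminates when the list has been run through, and outputs $X$. **Theorem.** Suppose that DualSearch, with any choice of $\lambda_0$, of the orders, and of the oracle $\mathcal O$, terminates with output $X$. Then: 1. $X\subseteq\chi_g$, and $g_X(\lambda)=g(\lambda)$ for all $\lambda\in S$, so that $X$ contains a minimizer of $L(\cdot,\lambda)$ for every $\lambda\in S$. 2. Every $x\in X$ is exactly optimal for the constraint instance $b=H(x)$: $f(x)=\min\{f(y): y\in\{0,1\}^n,\ H(y)=H(x)\}$. 3. If the elements of $\chi_g$ correspond to the $m$-dimensional facets of the graph of $g$ over $S$ (that is, for every $x\in\chi_g$ the set $\{\lambda\in S: L(x,\lambda)=g(\lambda)\}$ has nonempty interior in $\mathbb R^m$, and $P_x\ne P_y$ for distinct $x,y\in\chi_g$), then $X=\chi_g$. -/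

import Mathlib

namespace DualSearch

/-- The labellings `x ∈ {0,1}ⁿ`. -/
abbrev Label (n : ℕ) : Type := Fin n → Fin 2

/-- Points `q = (λ_q, z_q)` of `ℝ^{m+1} = ℝ^m × ℝ`; `q.1` is `λ_q` and `q.2` is `z_q`. -/
abbrev Pt (m : ℕ) : Type := (Fin m → ℝ) × ℝ

section Lagrangian

variable {m n : ℕ} (f : Label n → ℝ) (H : Label n → Fin m → ℝ)

/-- The Lagrangian `L(x,λ) = f(x) + λᵀ H(x)`. -/
def L (x : Label n) (lam : Fin m → ℝ) : ℝ := f x + ∑ i, lam i * H x i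

/-- `argmin_{x ∈ {0,1}ⁿ} L(x,λ)`. -/
def argmin (lam : Fin m → ℝ) : Set (Label n) := {x | ∀ y, L f H x lam ≤ L f H y lam}

/-- The characteristic set over a set `S` of multipliers. -/
def charSet (S : Set (Fin m → ℝ)) : Set (Label n) := ⋃ lam ∈ S, argmin f H lam

/-- The induced dual `g_X(λ) = min_{x ∈ X} L(x,λ)` (only used for nonempty `X`; as `{0,1}ⁿ` is
finite, the infimum is then a minimum). -/
noncomputable def inducedDual (X : Set (Label n)) (lam : Fin m → ℝ) : ℝ := ⨅ x : X, L f H x lam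

/-- The Lagrangian dual `g(λ) = min_{x ∈ {0,1}ⁿ} L(x,λ)`. -/
noncomputable def dual (lam : Fin m → ℝ) : ℝ := inducedDual f H Set.univ lam

/-- The hyperplane `P_x = {(λ,z) : z = L(x,λ)}`. -/
def hyperplane (x : Label n) : Set (Pt m) := {q | q.2 = L f H x q.1}

/-- `Γ_X(S) = {q : λ_q ∈ S, z_q ≤ g_X(λ_q)}`. -/
def Gam (X : Set (Label n)) (S : Set (Fin m → ℝ)) : Set (Pt m) :=
  {q | q.1 ∈ S ∧ q.2 ≤ inducedDual f H X q.1}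

/-- The elements of the characteristic set over `S` correspond to the `m`-dimensional facets of
the graph of `g` over `S`: for each such `x`, the part of the graph of `g` over `S` that lies in
`P_x` is `m`-dimensional (its projection to `ℝ^m` has nonempty interior), and different elements
have different hyperplanes. -/
def FacetCorrespondence (S : Set (Fin m → ℝ)) : Prop :=
  (∀ x ∈ charSet f H S, (interior {lam | lam ∈ S ∧ L f H x lam = dual f H lam}).Nonempty) ∧
    Set.InjOn (hyperplane f H) (charSet f H S)

end Lagrangian

section Box

variable {m : ℕ}

/-- The search box `∏ᵢ [loᵢ, hiᵢ]`. -/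
def box (lo hi : Fin m → ℝ) : Set (Fin m → ℝ) := {lam | ∀ i, lo i ≤ lam i ∧ lam i ≤ hi i}

/-- The `2^m` corners `∏ᵢ {loᵢ, hiᵢ}` of the box. -/
def corners (lo hi : Fin m → ℝ) : Set (Fin m → ℝ) := {lam | ∀ i, lam i = lo i ∨ lam i = hi i}

end Box

section Skeleton

variable {m : ℕ}

/-- `y` is a proper convex combination of `W = {p₁, …, p_k}`: `y = ∑ αᵢ pᵢ` for some
`α ∈ (0,1)^k` with `∑ αᵢ = 1`. -/
def IsProperConvexComb (y : Pt m) (W : Set (Pt m)) : Prop :=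
  ∃ (k : ℕ) (p : Fin k → Pt m) (α : Fin k → ℝ),
    Set.range p = W ∧ (∀ i, 0 < α i ∧ α i < 1) ∧ ∑ i, α i = 1 ∧ y = ∑ i, α i • p i

/-- The vertices of a convex set `C`: the `v ∈ C` such that if `v` is a proper convex combination
of `U ⊆ C`, then `U = {v}`. -/
def vertices (C : Set (Pt m)) : Set (Pt m) :=
  {v | v ∈ C ∧ ∀ U ⊆ C, IsProperConvexComb v U → U = {v}}

/-- The (bounded) edges of a convex set `C`: the segments `e(u,v)` between vertices `u`, `v` of `C`
such that if some `y ∈ e(u,v)` is a proper convex combination of `W ⊆ C`, then `W ⊆ e(u,v)`.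
The degenerate segments `e(u,u) = {u}` at vertices `u` are included; they play no role. -/
def edges (C : Set (Pt m)) : Set (Set (Pt m)) :=
  {e | ∃ u ∈ vertices C, ∃ v ∈ vertices C, e = segment ℝ u v ∧
    ∀ y ∈ segment ℝ u v, ∀ W ⊆ C, IsProperConvexComb y W → W ⊆ segment ℝ u v}

/-- The vertical edge `e(u,v)` with `v = (λ_u, -∞)`. -/
def downRay (u : Pt m) : Set (Pt m) := {q | q.1 = u.1 ∧ q.2 ≤ u.2}

/-- `ConvEdge(V)`: the edges of the convex hull of `V`. -/
def convEdge (V : Set (Pt m)) : Set (Set (Pt m)) := edges (convexHull ℝ V)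

/-- The edge set of the skeleton of `g_X` over the box: the bounded edges of `Γ_X(S)` and the
vertical edges below the vertices over the corners of the box. -/
def skeletonEdges {n : ℕ} (f : Label n → ℝ) (H : Label n → Fin m → ℝ) (lo hi : Fin m → ℝ)
    (X : Set (Label n)) : Set (Set (Pt m)) :=
  edges (Gam f H X (box lo hi)) ∪
    {e | ∃ u ∈ vertices (Gam f H X (box lo hi)), u.1 ∈ corners lo hi ∧ e = downRay u}

end Skeleton

section Algorithm

variable {m n : ℕ}

/-- A state of the algorithm. The ordered vertex list `𝒱` is `visited ++ pending`: the loop has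
already run through `visited`, and the next vertex is the head of `pending`. An edge is stored
as the set of its points. -/
structure State (m n : ℕ) where
  X : Set (Label n)
  visited : List (Pt m)
  pending : List (Pt m)
  E : Set (Set (Pt m))

/-- The vertex set `𝒱` of a state. -/
def State.V (s : State m n) : Set (Pt m) := {u | u ∈ s.visited ∨ u ∈ s.pending}

variable (f : Label n → ℝ) (H : Label n → Fin m → ℝ)

/-- `𝒱⁺ = {u ∈ P_x ∩ e : e ∈ ℰ, e ⊄ P_x}`. -/
def Vplus (E : Set (Set (Pt m))) (x : Label n) : Set (Pt m) :=
  {u | ∃ e ∈ E, ¬ e ⊆ hyperplane f H x ∧ u ∈ hyperplane f H x ∩ e}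

/-- `𝒱⁻ = {u ∈ 𝒱 : z_u > P_x(λ_u)}`. -/
def Vminus (V : Set (Pt m)) (x : Label n) : Set (Pt m) := {u | u ∈ V ∧ L f H x u.1 < u.2}

/-- `ℰ⁻`: the edges (bounded or vertical) that have an endpoint in `𝒱⁻`. -/
def Eminus (V : Set (Pt m)) (E : Set (Set (Pt m))) (x : Label n) : Set (Set (Pt m)) :=
  {e | e ∈ E ∧
    ((∃ u₁ u₂, e = segment ℝ u₁ u₂ ∧ (u₁ ∈ Vminus f H V x ∨ u₂ ∈ Vminus f H V x)) ∨
      ∃ u ∈ Vminus f H V x, e = downRay u)}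

/-- `ℰ⁺ = {e(u₁,u₃) : e(u₁,u₂) ∈ ℰ⁻, u₃ = e(u₁,u₂) ∩ P_x}`, the parts that remain of the edges in
`ℰ⁻`; `u₁` is the endpoint that is not removed, which for a vertical edge is its endpoint
at `-∞`. -/
def Eplus (V : Set (Pt m)) (E : Set (Set (Pt m))) (x : Label n) : Set (Set (Pt m)) :=
  {e | ∃ u₁ u₂ u₃, segment ℝ u₁ u₂ ∈ Eminus f H V E x ∧ u₁ ∉ Vminus f H V x ∧
      segment ℝ u₁ u₂ ∩ hyperplane f H x = {u₃} ∧ e = segment ℝ u₁ u₃} ∪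
  {e | ∃ u₂ u₃, downRay u₂ ∈ Eminus f H V E x ∧
      downRay u₂ ∩ hyperplane f H x = {u₃} ∧ e = downRay u₃}

/-- The states that `InitSkeleton()`, followed by an arbitrary ordering of `𝒱`, can produce with
oracle `O`. -/
def IsInit (lo hi : Fin m → ℝ) (O : (Fin m → ℝ) → Label n) (s : State m n) : Prop :=
  ∃ lam₀ ∈ corners lo hi,
    s.X = {O lam₀} ∧
    s.visited = [] ∧
    s.pending.Nodup ∧
    (∀ u, u ∈ s.pending ↔ u.1 ∈ corners lo hi ∧ u.2 = L f H (O lam₀) u.1) ∧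
    s.E = skeletonEdges f H lo hi s.X

/-- One iteration of the loop, for the vertex `v` at the head of the pending list and the oracle
answer `x_v = O(λ_v)`. If `P_{x_v}(λ_v) < z_v` fails, nothing is changed. Otherwise `x_v` is added
to `X`, the points of `𝒱⁺` that are not yet in `𝒱` are appended in an arbitrary order, `𝒱⁻` (which
contains `v`) is removed, and `ℰ` becomes `ℰ ∪ ConvEdge(𝒱⁺) ∪ ℰ⁺ - ℰ⁻`. -/
inductive Step (O : (Fin m → ℝ) → Label n) : State m n → State m n → Prop
  | confirm (s : State m n) (v : Pt m) (rest : List (Pt m))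
      (hv : s.pending = v :: rest)
      (hz : ¬ L f H (O v.1) v.1 < v.2) :
      Step O s ⟨s.X, s.visited ++ [v], rest, s.E⟩
  | cut (s : State m n) (v : Pt m) (rest new : List (Pt m))
      (hv : s.pending = v :: rest)
      (hz : L f H (O v.1) v.1 < v.2)
      (hnodup : new.Nodup)
      (hnew : ∀ u, u ∈ new ↔ u ∈ Vplus f H s.E (O v.1) ∧ u ∉ s.V) :
      Step O s
        ⟨insert (O v.1) s.X,
          s.visited.filter (fun u => u.2 ≤ L f H (O v.1) u.1),
          rest.filter (fun u => u.2 ≤ L f H (O v.1) u.1) ++ new,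
          (s.E ∪ convEdge (Vplus f H s.E (O v.1)) ∪ Eplus f H s.V s.E (O v.1)) \
            Eminus f H s.V s.E (O v.1)⟩

/-- `DualSearch` with oracle `O` on the box can terminate with output `X`: some run from an initial
state reaches a state without pending vertices in which the current set is `X`. -/
def TerminatesWith (lo hi : Fin m → ℝ) (O : (Fin m → ℝ) → Label n) (X : Set (Label n)) : Prop :=
  ∃ s₀ s : State m n, IsInit f H lo hi O s₀ ∧ Relation.ReflTransGen (Step f H O) s₀ s ∧
    s.pending = [] ∧ s.X = X

end Algorithm

end DualSearch

/-! The subgraph `Γ_X` is a polyhedron without vertical lines over a compact box. If `g_X` exceeds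
some `L(y,·)` somewhere on the box, then `L(y,λ) - z` has a negative minimum on `Γ_X`, attained at a
vertex (`exists_vertex_above`). Hence `g_X = g` on the box as soon as the oracle confirms every
vertex of `Γ_X`.

It remains to see that the list never misses a vertex. The stored points and edges need not be
exactly the skeleton: it suffices that they lie in `Γ_X` and include all its vertices and edges
(`Covers`), since superfluous points are merely checked too. `Covers.cut` shows that a cut by `P_x`
preserves this. A new vertex on `P_x` lies on an old edge leaving `P_x` (`exists_edge_through`), so
it is in `𝒱⁺`. A new edge inside `P_x` is an edge of the hull of `𝒱⁺`; any other is an old edge or a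
truncated one (`edge_of_edge_cut`). Both facts come from counting directions in which the tight
constraints stay tight (`tang`).

A confirmed point satisfies `z_v ≤ g(λ_v)`, a condition independent of `X`, so confirmation survives
later cuts. The statements on exact optimality and on facets then follow from oracle answers being
minimizers, and from a finite union of closed sets with empty interior containing no nonempty open
set. -/

namespace DualSearch

open Filter Topology

/-! ### Vertices, edges and extreme directions of polyhedra given by finitely many constraints. -/

section Polyhedra

variable {m : ℕ}

/-- The value at `q` of the affine function with linear part `a.1` and constant term `a.2`. -/
def ev (a : Module.Dual ℝ (Pt m) × ℝ) (q : Pt m) : ℝ := a.1 q + a.2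

/-- The polyhedron on which all affine functions in `A` are nonnegative. -/
def poly (A : Set (Module.Dual ℝ (Pt m) × ℝ)) : Set (Pt m) := {q | ∀ a ∈ A, 0 ≤ ev a q}

/-- The directions along which the constraints that are tight at `c` do not change. -/
def tang (A : Set (Module.Dual ℝ (Pt m) × ℝ)) (c : Pt m) : Set (Pt m) :=
  {d | ∀ a ∈ A, ev a c = 0 → a.1 d = 0}

variable {A : Set (Module.Dual ℝ (Pt m) × ℝ)} {a : Module.Dual ℝ (Pt m) × ℝ}

theorem ev_add_smul (a : Module.Dual ℝ (Pt m) × ℝ) (c d : Pt m) (t : ℝ) :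
    ev a (c + t • d) = ev a c + t * a.1 d := by
  simp [ev]; ring

theorem convex_poly (A : Set (Module.Dual ℝ (Pt m) × ℝ)) : Convex ℝ (poly A) := by
  intro x hx y hy s t hs ht hst a ha
  have e : ev a (s • x + t • y) = s * ev a x + t * ev a y := by
    simp only [ev, map_add, map_smul, smul_eq_mul]
    linear_combination (-a.2) * hst
  rw [e]
  have := hx a ha
  have := hy a ha
  positivity

theorem isProperConvexComb_pair (x y : Pt m) {s : ℝ} (h0 : 0 < s) (h1 : s < 1) :
    IsProperConvexComb (s • x + (1 - s) • y) {x, y} := by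
  refine ⟨2, ![x, y], ![s, 1 - s], by simp [Set.pair_comm], ?_, by simp, by simp⟩
  intro i
  fin_cases i <;> simp <;> constructor <;> linarith

theorem IsProperConvexComb.nonempty {y : Pt m} {W : Set (Pt m)} (h : IsProperConvexComb y W) :
    W.Nonempty := by
  obtain ⟨k, p, α, rfl, -, hs, -⟩ := h
  cases k with
  | zero => simp at hs
  | succ k => exact ⟨p 0, 0, rfl⟩

theorem IsProperConvexComb.ev_eq_zero {y : Pt m} {W : Set (Pt m)} (h : IsProperConvexComb y W)
    (hW : ∀ p ∈ W, 0 ≤ ev a p) (hy : ev a y = 0) : ∀ p ∈ W, ev a p = 0 := by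
  obtain ⟨k, p, α, rfl, hα, hs, rfl⟩ := h
  have e : ev a (∑ i, α i • p i) = ∑ i, α i * ev a (p i) := by
    simp only [ev, map_sum, map_smul, smul_eq_mul, mul_add, Finset.sum_add_distrib,
      ← Finset.sum_mul, hs, one_mul]
  rw [e, Finset.sum_eq_zero_iff_of_nonneg
    (fun i _ => mul_nonneg (hα i).1.le (hW _ ⟨i, rfl⟩))] at hy
  rintro _ ⟨i, rfl⟩
  exact (mul_eq_zero.1 (hy i (Finset.mem_univ _))).resolve_left (hα i).1.ne'

theorem IsProperConvexComb.sub_mem_tang {y c : Pt m} {W : Set (Pt m)}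
    (h : IsProperConvexComb y W) (hW : W ⊆ poly A)
    (hy : ∀ a ∈ A, ev a c = 0 → ev a y = 0) : ∀ p ∈ W, p - c ∈ tang A c := by
  intro p hp a ha hc
  have := h.ev_eq_zero (fun p hp => hW hp a ha) (hy a ha hc) p hp
  simp only [ev] at this hc
  rw [map_sub]
  linarith

theorem eventually_mem_poly (hA : A.Finite) {c d : Pt m} (hc : c ∈ poly A)
    (hd : ∀ a ∈ A, ev a c = 0 → 0 ≤ a.1 d) :
    ∀ᶠ t in 𝓝[>] (0 : ℝ), c + t • d ∈ poly A ∧ ∀ a ∈ A, ev a c ≠ 0 → 0 < ev a (c + t • d) := by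
  have h : ∀ᶠ t in 𝓝[>] (0 : ℝ), ∀ a ∈ A, 0 ≤ ev a (c + t • d) ∧
      (ev a c ≠ 0 → 0 < ev a (c + t • d)) := by
    rw [eventually_all_finite hA]
    intro a ha
    by_cases h0 : ev a c = 0
    · filter_upwards [self_mem_nhdsWithin] with t ht
      refine ⟨?_, fun h => (h h0).elim⟩
      rw [ev_add_smul, h0, zero_add]
      exact mul_nonneg (le_of_lt ht) (hd a ha h0)
    · have hpos : 0 < ev a c := lt_of_le_of_ne (hc a ha) (Ne.symm h0)
      have hcont : Tendsto (fun t : ℝ => ev a c + t * a.1 d) (𝓝[>] 0) (𝓝 (ev a c + 0 * a.1 d)) :=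
        ((by fun_prop : Continuous fun t : ℝ => ev a c + t * a.1 d).tendsto 0).mono_left
          nhdsWithin_le_nhds
      rw [zero_mul, add_zero] at hcont
      filter_upwards [hcont.eventually (lt_mem_nhds hpos)] with t ht
      rw [ev_add_smul]
      exact ⟨ht.le, fun _ => ht⟩
  filter_upwards [h] with t ht
  exact ⟨fun a ha => (ht a ha).1, fun a ha => (ht a ha).2⟩

theorem exists_pm_mem_poly (hA : A.Finite) {c d : Pt m} (hc : c ∈ poly A) (hd : d ∈ tang A c) :
    ∃ t : ℝ, 0 < t ∧ c + t • d ∈ poly A ∧ c - t • d ∈ poly A := by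
  have h1 := eventually_mem_poly hA hc (d := d) (fun a ha h0 => (hd a ha h0).ge)
  have h2 := eventually_mem_poly hA hc (d := -d) (fun a ha h0 => by simp [hd a ha h0])
  obtain ⟨t, ⟨h1, h2⟩, h3⟩ := ((h1.and h2).and self_mem_nhdsWithin).exists
  exact ⟨t, h3, h1.1, by simpa [sub_eq_add_neg] using h2.1⟩

theorem isProperConvexComb_pm (c d : Pt m) : IsProperConvexComb c {c + d, c - d} := by
  have := isProperConvexComb_pair (c + d) (c - d) (s := 1 / 2) (by norm_num) (by norm_num)
  convert this using 1
  module

/-- Slack constraints survive small moves, so a nonzero `d` in `tang A v` makes `v` the midpoint of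
two other feasible points. Conversely, the points of a proper combination equal to `v` satisfy with
equality every constraint tight at `v`, so they differ from `v` by elements of `tang A v`. -/
theorem mem_vertices_poly (hA : A.Finite) {v : Pt m} :
    v ∈ vertices (poly A) ↔ v ∈ poly A ∧ ∀ d ∈ tang A v, d = 0 := by
  constructor
  · rintro ⟨hv, h⟩
    refine ⟨hv, fun d hd => ?_⟩
    obtain ⟨t, ht, h1, h2⟩ := exists_pm_mem_poly hA hv hd
    have := h _ (Set.insert_subset h1 (Set.singleton_subset_iff.2 h2))
      (isProperConvexComb_pm v (t • d))
    have h3 : v + t • d ∈ ({v} : Set (Pt m)) := this ▸ Set.mem_insert _ _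
    simpa [ht.ne'] using h3
  · rintro ⟨hv, h⟩
    refine ⟨hv, fun U hU hvU => ?_⟩
    refine Set.eq_singleton_iff_nonempty_unique_mem.2 ⟨hvU.nonempty, fun p hp => ?_⟩
    exact sub_eq_zero.1 (h _ (hvU.sub_mem_tang hU (fun _ _ h => h) p hp))

theorem vertices_mono {C D : Set (Pt m)} (h : C ⊆ D) {v : Pt m} (hv : v ∈ C)
    (hD : v ∈ vertices D) : v ∈ vertices C :=
  ⟨hv, fun U hU => hD.2 U (hU.trans h)⟩

theorem segment_self_mem_edges {C : Set (Pt m)} {v : Pt m} (hv : v ∈ vertices C) :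
    segment ℝ v v ∈ edges C := by
  refine ⟨v, hv, v, hv, rfl, fun y hy W hW h => ?_⟩
  rw [segment_same] at *
  rw [Set.mem_singleton_iff.1 hy] at h
  exact (hv.2 W hW h).subset

theorem mem_segment_line {c d y : Pt m} {t₁ t₂ : ℝ} (h : t₁ ≤ t₂) :
    y ∈ segment ℝ (c + t₁ • d) (c + t₂ • d) ↔ ∃ t, t₁ ≤ t ∧ t ≤ t₂ ∧ y = c + t • d := by
  have e : segment ℝ (c + t₁ • d) (c + t₂ • d) = (fun t : ℝ => c + t • d) '' Set.Icc t₁ t₂ := by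
    rw [← segment_eq_Icc h]
    have := image_segment ℝ (AffineMap.lineMap c (c + d) : ℝ →ᵃ[ℝ] Pt m) t₁ t₂
    have e : ∀ t : ℝ, AffineMap.lineMap c (c + d) t = c + t • d := fun t => by
      simp [AffineMap.lineMap_apply, add_comm]
    simpa only [e] using this.symm
  rw [e]
  constructor
  · rintro ⟨t, ⟨h1, h2⟩, rfl⟩; exact ⟨t, h1, h2, rfl⟩
  · rintro ⟨t, h1, h2, rfl⟩; exact ⟨t, ⟨h1, h2⟩, rfl⟩

/-- Points combining to a point of the line keep the constraints tight at `c` tight, so they lie on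
the line as well. At either end of the interval a nonzero tangent direction would allow moving both
ways. -/
theorem edge_of_line (hA : A.Finite) {c d : Pt m} (hc : c ∈ poly A)
    (hd : d ∈ tang A c) (hspan : ∀ h ∈ tang A c, ∃ s : ℝ, h = s • d) {t₁ t₂ : ℝ}
    (ht : ∀ t : ℝ, c + t • d ∈ poly A ↔ t₁ ≤ t ∧ t ≤ t₂) :
    c + t₁ • d ∈ vertices (poly A) ∧ c + t₂ • d ∈ vertices (poly A) ∧
      segment ℝ (c + t₁ • d) (c + t₂ • d) ∈ edges (poly A) := by
  have h0 := (ht 0).1 (by simpa using hc)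
  have h12 : t₁ ≤ t₂ := h0.1.trans h0.2
  have hline : ∀ t : ℝ, ∀ a ∈ A, ev a c = 0 → ev a (c + t • d) = 0 := fun t a ha h => by
    rw [ev_add_smul, h, hd a ha h]; simp
  have key : ∀ t : ℝ, c + t • d ∈ poly A →
      (∀ s : ℝ, 0 < s → ¬ (t₁ ≤ t + s ∧ t + s ≤ t₂ ∧ t₁ ≤ t - s ∧ t - s ≤ t₂)) →
      c + t • d ∈ vertices (poly A) := by
    intro t hp hs
    refine (mem_vertices_poly hA).2 ⟨hp, fun h hh => ?_⟩
    obtain ⟨r, rfl⟩ := hspan h (fun a ha h0 => hh a ha (hline t a ha h0))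
    by_contra hne
    have hr : r ≠ 0 := fun h => hne (by simp [h])
    obtain ⟨e, he, h1, h2⟩ := exists_pm_mem_poly hA hp hh
    have e1 : c + t • d + e • r • d = c + (t + e * r) • d := by module
    have e2 : c + t • d - e • r • d = c + (t - e * r) • d := by module
    rw [e1, ht] at h1
    rw [e2, ht] at h2
    rcases lt_or_gt_of_ne hr with h | h
    · exact hs (-(e * r)) (by nlinarith) ⟨by linarith, by linarith, by linarith, by linarith⟩
    · exact hs (e * r) (by positivity) ⟨by linarith, by linarith, by linarith, by linarith⟩
  have v1 := key t₁ ((ht t₁).2 ⟨le_rfl, h12⟩) (fun s hs h => by linarith [h.2.2.1])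
  have v2 := key t₂ ((ht t₂).2 ⟨h12, le_rfl⟩) (fun s hs h => by linarith [h.2.1])
  refine ⟨v1, v2, _, v1, _, v2, rfl, fun y hy W hW hyW p hp => ?_⟩
  obtain ⟨t, -, -, rfl⟩ := (mem_segment_line h12).1 hy
  obtain ⟨s, hs⟩ := hspan _ (hyW.sub_mem_tang hW (hline t) p hp)
  have e : p = c + s • d := by rw [← hs]; abel
  have := (ht s).1 (e ▸ hW hp)
  exact (mem_segment_line h12).2 ⟨s, this.1, this.2, e⟩

/-- The ratio test of the simplex method: move from `d` along `h` until the first decreasing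
constraint reaches zero. -/
theorem exists_new_tight (hA : A.Finite) {u d h : Pt m}
    (hd : ∀ a ∈ A, ev a u = 0 → 0 ≤ a.1 d)
    (hh : ∀ a ∈ A, ev a u = 0 → a.1 d = 0 → a.1 h = 0)
    (hneg : ∃ a ∈ A, ev a u = 0 ∧ a.1 h < 0) :
    ∃ t : ℝ, 0 < t ∧ (∀ a ∈ A, ev a u = 0 → 0 ≤ a.1 (d + t • h)) ∧
      ∃ a ∈ A, ev a u = 0 ∧ a.1 d ≠ 0 ∧ a.1 (d + t • h) = 0 := by
  have hfin : {a ∈ A | ev a u = 0 ∧ a.1 h < 0}.Finite := hA.subset (Set.sep_subset _ _)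
  obtain ⟨b, ⟨hbA, hbu, hbh⟩, hmin⟩ :=
    Set.exists_min_image _ (fun a : Module.Dual ℝ (Pt m) × ℝ => a.1 d / -(a.1 h)) hfin hneg
  have hb0 : b.1 d ≠ 0 := fun h0 => hbh.ne (hh b hbA hbu h0)
  have hbpos : 0 < b.1 d := lt_of_le_of_ne (hd b hbA hbu) hb0.symm
  refine ⟨b.1 d / -(b.1 h), div_pos hbpos (by linarith), fun a ha hau => ?_,
    b, hbA, hbu, hb0, ?_⟩
  · simp only [map_add, map_smul, smul_eq_mul]
    rcases lt_or_ge (a.1 h) 0 with h' | h'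
    · have := hmin a ⟨ha, hau, h'⟩
      rw [le_div_iff₀ (by linarith)] at this
      linarith
    · have := hd a ha hau
      have h3 : 0 ≤ b.1 d / -(b.1 h) := (div_pos hbpos (by linarith)).le
      positivity
  · simp only [map_add, map_smul, smul_eq_mul]
    rw [div_neg, neg_mul, div_mul_cancel₀ _ hbh.ne, add_neg_cancel]

/-- Among the feasible directions with `ψ ≠ 0`, take one on which a maximal set of the constraints
tight at `u` vanishes. It spans an extreme ray, or a line when all of them vanish. -/
theorem exists_extreme_direction (hA : A.Finite) {u d₀ : Pt m} (ψ : Module.Dual ℝ (Pt m))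
    (hT : ∀ d ∈ tang A u, ψ d = 0 → d = 0)
    (hd₀ : ∀ a ∈ A, ev a u = 0 → 0 ≤ a.1 d₀) (hψ : ψ d₀ ≠ 0) :
    ∃ d, ψ d ≠ 0 ∧ (∀ a ∈ A, ev a u = 0 → 0 ≤ a.1 d) ∧
      ∀ h, (∀ a ∈ A, ev a u = 0 → a.1 d = 0 → a.1 h = 0) → ∃ s : ℝ, h = s • d := by
  let D : Set (Pt m) := {d | ψ d ≠ 0 ∧ ∀ a ∈ A, ev a u = 0 → 0 ≤ a.1 d}
  let tight : Pt m → Set (Module.Dual ℝ (Pt m) × ℝ) := fun d => {a ∈ A | ev a u = 0 ∧ a.1 d = 0}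
  have hfin : (tight '' D).Finite :=
    hA.finite_subsets.subset (by rintro _ ⟨d, -, rfl⟩; exact Set.sep_subset _ _)
  obtain ⟨_, ⟨d, ⟨hdψ, hd⟩, rfl⟩, hmax⟩ := hfin.exists_maximal ⟨_, d₀, ⟨hψ, hd₀⟩, rfl⟩
  have hmax' : ∀ d' ∈ D, tight d ⊆ tight d' → tight d' ⊆ tight d :=
    fun d' hd' h => hmax ⟨d', hd', rfl⟩ h
  refine ⟨d, hdψ, hd, fun h hh => ?_⟩
  by_cases hall : ∀ a ∈ A, ev a u = 0 → a.1 d = 0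
  · refine ⟨ψ h / ψ d, sub_eq_zero.1 (hT _ (fun a ha hau => ?_) ?_)⟩
    · simp [hh a ha hau (hall a ha hau), hall a ha hau]
    · simp [hdψ]
  push Not at hall
  obtain ⟨a₀, ha₀, ha₀u, ha₀d⟩ := hall
  -- A nonzero tangent `e` would have `ψ e ≠ 0` and kill every tight constraint, against maximality
  -- of `d`.
  have htriv : ∀ e ∈ tang A u, e = 0 := by
    intro e he
    by_contra hne
    have h1 := hmax' e ⟨fun h => hne (hT e he h), fun a ha hau => (he a ha hau).ge⟩
      (fun a ha => ⟨ha.1, ha.2.1, he a ha.1 ha.2.1⟩)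
    exact ha₀d (h1 ⟨ha₀, ha₀u, he a₀ ha₀ ha₀u⟩).2.2
  let I : Finset (Module.Dual ℝ (Pt m) × ℝ) :=
    (hA.subset (Set.sep_subset A fun a => ev a u = 0)).toFinset
  have hI : ∀ a, a ∈ I ↔ a ∈ A ∧ ev a u = 0 := fun a => by simp [I]
  -- `σ` is positive on `d`, so subtracting a multiple of `d` from `h` gives `k` with `σ k = 0`. If
  -- `k ≠ 0`, the tight constraints then take both signs on `k`.
  let σ : Pt m → ℝ := fun e => ∑ a ∈ I, a.1 e
  have hσd : 0 < σ d := by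
    refine Finset.sum_pos' (fun a ha => hd a ((hI a).1 ha).1 ((hI a).1 ha).2) ⟨a₀, ?_, ?_⟩
    · exact (hI _).2 ⟨ha₀, ha₀u⟩
    · exact lt_of_le_of_ne (hd _ ha₀ ha₀u) (Ne.symm ha₀d)
  refine ⟨σ h / σ d, ?_⟩
  by_contra hne
  obtain ⟨k, hk⟩ : ∃ k, k = h - (σ h / σ d) • d := ⟨_, rfl⟩
  have hk0 : k ≠ 0 := by rw [hk]; exact sub_ne_zero.2 hne
  have hσk : σ k = 0 := by
    have : σ k = σ h - σ h / σ d * σ d := by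
      simp only [σ, hk, map_sub, map_smul, smul_eq_mul, Finset.sum_sub_distrib, Finset.mul_sum]
    rw [this, div_mul_cancel₀ _ hσd.ne', sub_self]
  have hkt : ∀ a ∈ A, ev a u = 0 → a.1 d = 0 → a.1 k = 0 := fun a ha hau had => by
    simp [hk, hh a ha hau had, had]
  have hnz : ∃ a ∈ I, a.1 k ≠ 0 := by
    by_contra hcon
    push Not at hcon
    exact hk0 (htriv k fun a ha hau => hcon a ((hI a).2 ⟨ha, hau⟩))
  -- Moving along `k` makes a new constraint vanish; by maximality this is possible only if `ψ`
  -- vanishes there. Applied to `k` and `-k`, this forces `ψ k = 0` and then `ψ d = 0`.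
  have main : ∀ k : Pt m, (∀ a ∈ A, ev a u = 0 → a.1 d = 0 → a.1 k = 0) →
      (∃ a ∈ A, ev a u = 0 ∧ a.1 k < 0) → ∃ t : ℝ, 0 < t ∧ ψ d + t * ψ k = 0 := by
    intro k hkt hkneg
    obtain ⟨t, ht, h1, a, ha, hau, had, hak⟩ := exists_new_tight hA hd hkt hkneg
    refine ⟨t, ht, ?_⟩
    by_contra hcon
    have h2 := hmax' (d + t • k) ⟨by simpa using hcon, h1⟩ (fun b hb => ⟨hb.1, hb.2.1, by
      simp [hb.2.2, hkt b hb.1 hb.2.1 hb.2.2]⟩)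
    exact had (h2 ⟨ha, hau, hak⟩).2.2
  obtain ⟨b, hb, hbk⟩ := Finset.exists_pos_of_sum_zero_of_exists_nonzero _ hσk hnz
  obtain ⟨b', hb', hbk'⟩ := Finset.exists_pos_of_sum_zero_of_exists_nonzero
    (fun a : Module.Dual ℝ (Pt m) × ℝ => a.1 (-k)) (s := I)
    (by simpa [σ] using hσk) (by simpa using hnz)
  obtain ⟨t, ht, h1⟩ := main k hkt
    ⟨b', ((hI _).1 hb').1, ((hI _).1 hb').2, by simpa using hbk'⟩
  obtain ⟨t', ht', h2⟩ := main (-k) (fun a ha hau had => by simp [hkt a ha hau had])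
    ⟨b, ((hI _).1 hb).1, ((hI _).1 hb).2, by simpa using hbk⟩
  rw [map_neg] at h2
  have h3 : (t + t') * ψ k = 0 := by linarith
  have h4 : ψ k = 0 := (mul_eq_zero.1 h3).resolve_left (by positivity)
  rw [h4] at h1
  exact hdψ (by linarith)

/-- A vertex `u` of a hyperplane section lies on a line spanned by a one-dimensional face that
leaves the hyperplane. -/
theorem exists_transversal_line (hA : A.Finite) {u w : Pt m} (ψ : Module.Dual ℝ (Pt m))
    (hu : u ∈ poly A) (hT : ∀ d ∈ tang A u, ψ d = 0 → d = 0) (hw : w ∈ poly A)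
    (hψ : ψ w ≠ ψ u) :
    ∃ (d : Pt m) (t : ℝ), ψ d ≠ 0 ∧ 0 < t ∧ u + t • d ∈ poly A ∧ d ∈ tang A (u + t • d) ∧
      ∀ h ∈ tang A (u + t • d), ∃ s : ℝ, h = s • d := by
  obtain ⟨d, hdψ, hd, hspan⟩ := exists_extreme_direction hA ψ hT (d₀ := w - u)
    (fun a ha hau => by
      have := hw a ha
      simp only [ev] at this hau
      rw [map_sub]; linarith) (by rw [map_sub]; exact sub_ne_zero.2 hψ)
  obtain ⟨t, ⟨h1, h2⟩, ht⟩ := ((eventually_mem_poly hA hu hd).and self_mem_nhdsWithin).exists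
  have ht : 0 < t := ht
  refine ⟨d, t, hdψ, ht, h1, fun a ha hac => ?_, fun h hh => hspan h fun a ha hau had => ?_⟩
  · have hau : ev a u = 0 := by
      by_contra hcon
      exact (h2 a ha hcon).ne' hac
    rw [ev_add_smul, hau, zero_add] at hac
    exact (mul_eq_zero.1 hac).resolve_left ht.ne'
  · refine hh a ha ?_
    rw [ev_add_smul, hau, had]; simp

end Polyhedra

/-! ### The polyhedron `Γ_X`, its vertices and edges, and their behaviour under a cut. -/

section Subgraph

variable {m n : ℕ} (f : Label n → ℝ) (H : Label n → Fin m → ℝ) (lo hi : Fin m → ℝ)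

/-- The affine function `q ↦ L(x, λ_q) - z_q`. -/
def below (x : Label n) : Module.Dual ℝ (Pt m) × ℝ :=
  (∑ i, H x i • (LinearMap.proj i ∘ₗ LinearMap.fst ℝ (Fin m → ℝ) ℝ) -
    LinearMap.snd ℝ (Fin m → ℝ) ℝ, f x)

/-- The affine function `q ↦ (λ_q)ᵢ - loᵢ`. -/
def aboveLo (i : Fin m) : Module.Dual ℝ (Pt m) × ℝ :=
  (LinearMap.proj i ∘ₗ LinearMap.fst ℝ (Fin m → ℝ) ℝ, -lo i)

/-- The affine function `q ↦ hiᵢ - (λ_q)ᵢ`. -/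
def belowHi (i : Fin m) : Module.Dual ℝ (Pt m) × ℝ :=
  (-(LinearMap.proj i ∘ₗ LinearMap.fst ℝ (Fin m → ℝ) ℝ), hi i)

/-- The constraints that define `Γ_X` over a box. -/
def constraints (X : Set (Label n)) : Set (Module.Dual ℝ (Pt m) × ℝ) :=
  below f H '' X ∪ (Set.range (aboveLo lo) ∪ Set.range (belowHi hi))

theorem constraints_finite (X : Set (Label n)) : (constraints f H lo hi X).Finite :=
  (X.toFinite.image _).union ((Set.finite_range _).union (Set.finite_range _))

theorem constraints_insert (x : Label n) (X : Set (Label n)) :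
    constraints f H lo hi (insert x X) = insert (below f H x) (constraints f H lo hi X) := by
  simp [constraints, Set.image_insert_eq, Set.insert_union]

theorem below_fst_apply (x : Label n) (d : Pt m) :
    (below f H x).1 d = ∑ i, d.1 i * H x i - d.2 := by
  simp [below, mul_comm]

theorem ev_below (x : Label n) (q : Pt m) : ev (below f H x) q = L f H x q.1 - q.2 := by
  rw [ev, below_fst_apply, L, below]; ring

theorem ev_aboveLo (i : Fin m) (q : Pt m) : ev (aboveLo lo i) q = q.1 i - lo i := by
  simp [ev, aboveLo, sub_eq_add_neg]

theorem ev_belowHi (i : Fin m) (q : Pt m) : ev (belowHi hi i) q = hi i - q.1 i := by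
  simp [ev, belowHi, sub_eq_add_neg, add_comm]

theorem aboveLo_fst_apply (i : Fin m) (d : Pt m) : (aboveLo lo i).1 d = d.1 i := by
  simp [aboveLo]

theorem belowHi_fst_apply (i : Fin m) (d : Pt m) : (belowHi hi i).1 d = -d.1 i := by
  simp [belowHi]

variable {f H lo hi}

theorem mem_hyperplane_iff {x : Label n} {q : Pt m} :
    q ∈ hyperplane f H x ↔ ev (below f H x) q = 0 := by
  rw [ev_below, hyperplane, Set.mem_ofPred_eq, sub_eq_zero, eq_comm]

theorem le_inducedDual_iff {X : Set (Label n)} (hX : X.Nonempty) {lam : Fin m → ℝ} {z : ℝ} :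
    z ≤ inducedDual f H X lam ↔ ∀ x ∈ X, z ≤ L f H x lam := by
  have := hX.to_subtype
  rw [inducedDual, le_ciInf_iff (Set.finite_range _).bddBelow, Subtype.forall]

theorem inducedDual_le {X : Set (Label n)} {x : Label n} (hx : x ∈ X) (lam : Fin m → ℝ) :
    inducedDual f H X lam ≤ L f H x lam :=
  (le_inducedDual_iff ⟨x, hx⟩).1 le_rfl x hx

theorem exists_inducedDual_eq {X : Set (Label n)} (hX : X.Nonempty) (lam : Fin m → ℝ) :
    ∃ x ∈ X, L f H x lam = inducedDual f H X lam := by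
  obtain ⟨x, hx, hmin⟩ := Set.exists_min_image X (fun x => L f H x lam) X.toFinite hX
  exact ⟨x, hx, le_antisymm ((le_inducedDual_iff hX).2 hmin) (inducedDual_le hx lam)⟩

theorem mem_Gam_iff {X : Set (Label n)} (hX : X.Nonempty) {S : Set (Fin m → ℝ)} {q : Pt m} :
    q ∈ Gam f H X S ↔ q.1 ∈ S ∧ ∀ x ∈ X, q.2 ≤ L f H x q.1 := by
  rw [Gam, Set.mem_ofPred_eq, le_inducedDual_iff hX]

theorem Gam_eq_poly {X : Set (Label n)} (hX : X.Nonempty) :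
    Gam f H X (box lo hi) = poly (constraints f H lo hi X) := by
  ext q
  simp only [mem_Gam_iff hX, box, poly, constraints, Set.mem_ofPred_eq, Set.mem_union,
    Set.mem_image, Set.mem_range, or_imp, forall_and, forall_exists_index, and_imp,
    forall_apply_eq_imp_iff₂, forall_apply_eq_imp_iff, ev_below, ev_aboveLo, ev_belowHi,
    sub_nonneg]
  tauto

theorem mem_Gam_insert {x : Label n} {X : Set (Label n)} (hX : X.Nonempty) {S : Set (Fin m → ℝ)}
    {q : Pt m} : q ∈ Gam f H (insert x X) S ↔ q ∈ Gam f H X S ∧ q.2 ≤ L f H x q.1 := by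
  rw [mem_Gam_iff hX, mem_Gam_iff (Set.insert_nonempty _ _)]
  simp only [Set.forall_mem_insert]
  tauto

theorem Gam_insert_subset {x : Label n} {X : Set (Label n)} (hX : X.Nonempty)
    {S : Set (Fin m → ℝ)} : Gam f H (insert x X) S ⊆ Gam f H X S :=
  fun _ h => ((mem_Gam_insert hX).1 h).1

theorem convex_Gam {X : Set (Label n)} (hX : X.Nonempty) :
    Convex ℝ (Gam f H X (box lo hi)) := Gam_eq_poly hX ▸ convex_poly _

theorem downRay_subset_Gam {X : Set (Label n)} {S : Set (Fin m → ℝ)} {u : Pt m}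
    (hu : u ∈ Gam f H X S) : downRay u ⊆ Gam f H X S := fun _ hq =>
  ⟨hq.1 ▸ hu.1, hq.2.trans (hq.1 ▸ hu.2)⟩

theorem mem_tang_constraints {X : Set (Label n)} {c d : Pt m} :
    d ∈ tang (constraints f H lo hi X) c ↔
      (∀ x ∈ X, L f H x c.1 = c.2 → ∑ i, d.1 i * H x i = d.2) ∧
        ∀ i, c.1 i = lo i ∨ c.1 i = hi i → d.1 i = 0 := by
  simp only [tang, constraints, Set.mem_ofPred_eq, Set.mem_union,
    Set.mem_image, Set.mem_range, or_imp, forall_and, forall_exists_index, and_imp,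
    forall_apply_eq_imp_iff₂, forall_apply_eq_imp_iff, ev_below, ev_aboveLo, ev_belowHi,
    below_fst_apply, aboveLo_fst_apply, belowHi_fst_apply, sub_eq_zero, neg_eq_zero]
  constructor
  · rintro ⟨h1, h2, h3⟩; exact ⟨h1, h2, fun i hi => h3 i hi.symm⟩
  · rintro ⟨h1, h2, h3⟩; exact ⟨h1, h2, fun i hi => h3 i hi.symm⟩

theorem mem_vertices_Gam {X : Set (Label n)} (hX : X.Nonempty) {v : Pt m} :
    v ∈ vertices (Gam f H X (box lo hi)) ↔
      v ∈ Gam f H X (box lo hi) ∧ ∀ d ∈ tang (constraints f H lo hi X) v, d = 0 := by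
  rw [Gam_eq_poly hX, mem_vertices_poly (constraints_finite f H lo hi X)]

theorem corner_mem_vertices {X : Set (Label n)} (hX : X.Nonempty) {lam : Fin m → ℝ}
    (hlo : ∀ i, lo i ≤ hi i) (hlam : lam ∈ corners lo hi) :
    (lam, inducedDual f H X lam) ∈ vertices (Gam f H X (box lo hi)) := by
  refine (mem_vertices_Gam hX).2 ⟨⟨fun i => ?_, le_rfl⟩, fun d hd => ?_⟩
  · rcases hlam i with h | h <;> simp [h, hlo i]
  · rw [mem_tang_constraints] at hd
    have h1 : d.1 = 0 := funext fun i => hd.2 i (hlam i)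
    obtain ⟨x, hx, he⟩ := exists_inducedDual_eq (f := f) (H := H) hX lam
    have h2 := hd.1 x hx he
    exact Prod.ext h1 (by simpa [h1] using h2.symm)

/-- Off the corners one can slide inside `P_x` along a free coordinate; strictly below `P_x` one can
move vertically. -/
theorem vertices_Gam_singleton {x : Label n} {v : Pt m}
    (hv : v ∈ vertices (Gam f H {x} (box lo hi))) :
    v.1 ∈ corners lo hi ∧ v.2 = L f H x v.1 := by
  have hv' := ((mem_vertices_Gam (Set.singleton_nonempty x)).1 hv).2
  simp only [mem_tang_constraints, Set.mem_singleton_iff, forall_eq] at hv'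
  constructor
  · intro i
    by_contra hcon
    have := hv' (Pi.single i 1, H x i) ⟨fun _ => by simp [Pi.single_apply], fun j hj => by
      have : j ≠ i := by rintro rfl; exact hcon hj
      simp [this]⟩
    simpa using congrFun (congrArg Prod.fst this) i
  · by_contra hcon
    have := hv' (0, 1) ⟨fun h => (hcon h.symm).elim, fun _ _ => rfl⟩
    simpa using congrArg Prod.snd this

theorem exists_Icc_of_line {X : Set (Label n)} (hX : X.Nonempty) {c d : Pt m} (hd : d.1 ≠ 0)
    (hc : c ∈ Gam f H X (box lo hi)) :
    ∃ t₁ t₂ : ℝ, ∀ t : ℝ, c + t • d ∈ Gam f H X (box lo hi) ↔ t₁ ≤ t ∧ t ≤ t₂ := by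
  let T : Set ℝ := {t | c + t • d ∈ Gam f H X (box lo hi)}
  obtain ⟨i, hi'⟩ := Function.ne_iff.1 hd
  have hclosed : IsClosed T := by
    have : T = ⋂ a ∈ constraints f H lo hi X, {t : ℝ | 0 ≤ ev a c + t * a.1 d} := by
      ext t
      simp only [T, Gam_eq_poly hX, poly, Set.mem_ofPred_eq, Set.mem_iInter, ev_add_smul]
    rw [this]
    exact isClosed_biInter fun a _ => isClosed_le (by fun_prop) (by fun_prop)
  have hbdd : T ⊆ Set.Icc (-((hi i - lo i) / |d.1 i|)) ((hi i - lo i) / |d.1 i|) := by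
    intro t ht
    have h1 := hc.1 i
    have h2 : lo i ≤ c.1 i + t * d.1 i ∧ c.1 i + t * d.1 i ≤ hi i := by simpa using ht.1 i
    rw [Set.mem_Icc, ← abs_le, le_div_iff₀ (abs_pos.2 hi'), ← abs_mul, abs_le]
    constructor <;> linarith [h1.1, h1.2, h2.1, h2.2]
  have hconv : Convex ℝ T := by
    intro s hs t ht α β hα hβ hαβ
    have := convex_Gam hX hs ht hα hβ hαβ
    have e : α • (c + s • d) + β • (c + t • d) = c + (α • s + β • t) • d := by
      have : c = (α + β) • c := by rw [hαβ, one_smul]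
      conv_rhs => rw [this]
      simp only [smul_eq_mul]
      module
    rwa [e] at this
  have hcomp : IsCompact T := isCompact_Icc.of_isClosed_subset hclosed hbdd
  have h0 : (0 : ℝ) ∈ T := by simpa [T] using hc
  have := eq_Icc_of_connected_compact ⟨⟨0, h0⟩, hconv.isPreconnected⟩ hcomp
  exact ⟨sInf T, sSup T, fun t => (Set.ext_iff.1 this t)⟩

/-- A one-dimensional face of `Γ_X` in a vertical direction lies over a corner. -/
theorem mem_corners_of_vertical {X : Set (Label n)} {c d : Pt m} (hd0 : d ≠ 0) (hd1 : d.1 = 0)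
    (hd : d ∈ tang (constraints f H lo hi X) c)
    (hspan : ∀ h ∈ tang (constraints f H lo hi X) c, ∃ s : ℝ, h = s • d) :
    c.1 ∈ corners lo hi := by
  have hd2 : d.2 ≠ 0 := fun h => hd0 (Prod.ext hd1 h)
  rw [mem_tang_constraints] at hd
  intro i
  by_contra hcon
  obtain ⟨s, hs⟩ := hspan (Pi.single i 1, 0) (mem_tang_constraints.2 ⟨fun x hx he => by
    have := hd.1 x hx he
    simp only [hd1] at this
    exact (hd2 (by simpa using this.symm)).elim, fun j hj => by
    have : j ≠ i := by rintro rfl; exact hcon hj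
    simp [this]⟩)
  simpa [hd1] using congrFun (congrArg Prod.fst hs) i

/-- Since `u` is a vertex after the cut, no nonzero direction tangent to `Γ_X` at `u` is parallel to
`P_x`. As `w` lies off `P_x`, some one-dimensional face of `Γ_X` through `u` leaves `P_x`; it is a
ray over a corner if vertical and a bounded edge otherwise. -/
theorem exists_edge_through {X : Set (Label n)} (hX : X.Nonempty) (hlo : ∀ i, lo i ≤ hi i)
    {x : Label n} {u w : Pt m}
    (hu : u ∈ vertices (Gam f H (insert x X) (box lo hi))) (hux : u ∈ hyperplane f H x)
    (hw : w ∈ Gam f H X (box lo hi)) (hwx : w ∉ hyperplane f H x) :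
    ∃ e ∈ skeletonEdges f H lo hi X, u ∈ e ∧ ¬ e ⊆ hyperplane f H x := by
  have hfin := constraints_finite f H lo hi X
  obtain ⟨hu1, hu2⟩ := (mem_vertices_Gam (Set.insert_nonempty _ _)).1 hu
  have hu1 := Gam_insert_subset hX hu1
  rw [mem_hyperplane_iff] at hux hwx
  have hu3 : ∀ d ∈ tang (constraints f H lo hi X) u, (below f H x).1 d = 0 → d = 0 := by
    intro d hd h0
    refine hu2 d ?_
    rw [constraints_insert]
    rintro a (rfl | ha) h
    · exact h0
    · exact hd a ha h
  obtain ⟨d, t, hdψ, ht, hc, hd, hspan⟩ := exists_transversal_line hfin (below f H x).1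
    (Gam_eq_poly hX ▸ hu1) hu3 (Gam_eq_poly hX ▸ hw) (fun h => hwx (by
      rw [ev, h]; exact hux))
  set c := u + t • d with hcdef
  have hu : u = c + (-t) • d := by rw [hcdef]; module
  have hcx : c ∉ hyperplane f H x := by
    rw [mem_hyperplane_iff, hcdef, ev_add_smul, hux, zero_add]
    exact mul_ne_zero ht.ne' hdψ
  rw [← Gam_eq_poly hX] at hc
  by_cases hd1 : d.1 = 0
  · have hcor := mem_corners_of_vertical (fun h => hdψ (by simp [h])) hd1 hd hspan
    have hcu : c.1 = u.1 := by simp [hcdef, hd1]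
    refine ⟨_, Or.inr ⟨_, corner_mem_vertices hX hlo hcor, hcor, rfl⟩, ⟨hcu.symm, ?_⟩, fun h => ?_⟩
    · rw [hcu]; exact hu1.2
    · exact hcx (h ⟨rfl, hc.2⟩)
  · obtain ⟨t₁, t₂, hT⟩ := exists_Icc_of_line hX hd1 hc
    have h0 := (hT 0).1 (by simpa using hc)
    have hu0 := (hT (-t)).1 (by rwa [← hu])
    have h12 := h0.1.trans h0.2
    rw [Gam_eq_poly hX] at hT hc
    refine ⟨_, Or.inl (Gam_eq_poly hX ▸ (edge_of_line hfin hc hd hspan hT).2.2), ?_, fun h => ?_⟩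
    · exact (mem_segment_line h12).2 ⟨-t, hu0.1, hu0.2, hu⟩
    · exact hcx (h ((mem_segment_line h12).2 ⟨0, h0.1, h0.2, by simp⟩))

/-- The end at `c - d` of an edge of the polyhedron cut by `x`, if it is not an end of the face
of the uncut polyhedron, lies on the hyperplane. -/
theorem ev_cut_end {B : Module.Dual ℝ (Pt m) × ℝ} {c d : Pt m} {t₁ t₂ : ℝ} (ht₁ : t₁ < -1)
    (ht₂ : -1 ≤ t₂) (h0 : 0 ≤ ev B (c + (-1 : ℝ) • d))
    (hcut : ∀ t : ℝ, t₁ ≤ t → t ≤ t₂ → 0 ≤ ev B (c + t • d) → -1 ≤ t) :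
    ev B (c + (-1 : ℝ) • d) = 0 ∧ ev B (c + t₁ • d) < 0 := by
  have h1 : ev B (c + t₁ • d) < 0 := by
    by_contra hcon
    have := hcut t₁ le_rfl (by linarith) (not_lt.1 hcon)
    linarith
  refine ⟨?_, h1⟩
  by_contra hne
  have hpos := lt_of_le_of_ne h0 (Ne.symm hne)
  rw [ev_add_smul] at hpos h1
  have hb : 0 < B.1 d := by nlinarith
  -- The affine function vanishes at this parameter, which would lie strictly between `t₁` and `-1`
  -- and so contradict `hcut`.
  have h2 : ev B c + -(ev B c / B.1 d) * B.1 d = 0 := by field_simp; ring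
  have h3 : t₁ ≤ -(ev B c / B.1 d) := by nlinarith
  have h4 : -(ev B c / B.1 d) < -1 := by nlinarith
  have := hcut _ h3 (by linarith) (by rw [ev_add_smul, h2])
  linarith

theorem truncated_line {B : Module.Dual ℝ (Pt m) × ℝ} {c d : Pt m} {t₁ : ℝ} (ht₁ : t₁ < -1)
    (hc : 0 < ev B c) (h0 : 0 ≤ ev B (c + (-1 : ℝ) • d))
    (hcut : ∀ t : ℝ, t₁ ≤ t → t ≤ 1 → 0 ≤ ev B (c + t • d) → -1 ≤ t) :
    ev B (c + t₁ • d) < 0 ∧ 0 ≤ ev B (c + (1 : ℝ) • d) ∧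
      segment ℝ (c + (1 : ℝ) • d) (c + t₁ • d) ∩ {q | ev B q = 0} = {c + (-1 : ℝ) • d} := by
  obtain ⟨h1, h2⟩ := ev_cut_end ht₁ (by norm_num) h0 hcut
  have hd : ev B c = B.1 d := by
    rw [ev_add_smul] at h1
    linarith
  refine ⟨h2, by rw [ev_add_smul]; linarith, ?_⟩
  rw [segment_symm]
  ext y
  rw [Set.mem_inter_iff, mem_segment_line (by linarith), Set.mem_singleton_iff]
  constructor
  · rintro ⟨⟨t, -, -, rfl⟩, h⟩
    have h : ev B (c + t • d) = 0 := h
    rw [ev_add_smul, hd] at h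
    have h' : (1 + t) * B.1 d = 0 := by linarith
    have : t = -1 := by linarith [(mul_eq_zero.1 h').resolve_right (by linarith)]
    rw [this]
  · rintro rfl
    exact ⟨⟨-1, ht₁.le, by norm_num, rfl⟩, h1⟩

theorem vertex_snd_eq {X : Set (Label n)} (hX : X.Nonempty) {v : Pt m}
    (hv : v ∈ vertices (Gam f H X (box lo hi))) : v.2 = inducedDual f H X v.1 := by
  refine le_antisymm hv.1.2 (not_lt.1 fun hlt => ?_)
  have := ((mem_vertices_Gam hX).1 hv).2 (0, 1) (mem_tang_constraints.2
    ⟨fun x hx he => (hlt.not_ge (he ▸ inducedDual_le hx v.1)).elim, fun _ _ => rfl⟩)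
  simpa using congrArg Prod.snd this

theorem mem_tang_constraints_insert {X : Set (Label n)} {x : Label n} {c d : Pt m}
    (hc : ev (below f H x) c ≠ 0) (hd : d ∈ tang (constraints f H lo hi X) c) :
    d ∈ tang (constraints f H lo hi (insert x X)) c := by
  rw [constraints_insert]
  rintro a (rfl | ha) h
  · exact (hc h).elim
  · exact hd a ha h

theorem vertex_of_vertex_cut {X : Set (Label n)} (hX : X.Nonempty) {x : Label n} {v : Pt m}
    (hv : v ∈ vertices (Gam f H (insert x X) (box lo hi))) (hvx : v ∉ hyperplane f H x) :
    v ∈ vertices (Gam f H X (box lo hi)) := by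
  obtain ⟨h1, h2⟩ := (mem_vertices_Gam (Set.insert_nonempty _ _)).1 hv
  refine (mem_vertices_Gam hX).2 ⟨Gam_insert_subset hX h1, fun d hd => h2 d ?_⟩
  exact mem_tang_constraints_insert (fun h => hvx (mem_hyperplane_iff.2 h)) hd

/-- The midpoint `c` of the edge lies strictly below `P_x`, so near `c` the cut is invisible and the
same line carries an edge of `Γ_X`. This edge can extend the given one only beyond an end on `P_x`,
hence at one end at most. -/
theorem edge_of_edge_cut {X : Set (Label n)} (hX : X.Nonempty) {x : Label n} {e : Set (Pt m)}
    (he : e ∈ edges (Gam f H (insert x X) (box lo hi))) (hex : ¬ e ⊆ hyperplane f H x) :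
    e ∈ edges (Gam f H X (box lo hi)) ∨
      ∃ u₁ u₂ u₃, segment ℝ u₁ u₂ ∈ edges (Gam f H X (box lo hi)) ∧
        u₂ ∈ vertices (Gam f H X (box lo hi)) ∧ L f H x u₂.1 < u₂.2 ∧ u₁.2 ≤ L f H x u₁.1 ∧
        segment ℝ u₁ u₂ ∩ hyperplane f H x = {u₃} ∧ e = segment ℝ u₁ u₃ := by
  obtain ⟨a, ha, b, hb, rfl, hface⟩ := he
  by_cases hab : a = b
  · subst hab
    rw [segment_same, Set.singleton_subset_iff] at hex
    exact Or.inl (segment_self_mem_edges (vertex_of_vertex_cut hX ha hex))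
  have hXi : (insert x X).Nonempty := Set.insert_nonempty _ _
  have hfin := constraints_finite f H lo hi X
  have hfini := constraints_finite f H lo hi (insert x X)
  obtain ⟨c, hc⟩ : ∃ c : Pt m, c = (1 / 2 : ℝ) • (a + b) := ⟨_, rfl⟩
  obtain ⟨d, hd⟩ : ∃ d : Pt m, d = (1 / 2 : ℝ) • (b - a) := ⟨_, rfl⟩
  have ea : a = c + (-1 : ℝ) • d := by rw [hc, hd]; module
  have eb : b = c + (1 : ℝ) • d := by rw [hc, hd]; module
  have hd0 : d ≠ 0 := by
    rintro rfl
    exact hab (by rw [ea, eb]; simp)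
  have hd1 : d.1 ≠ 0 := by
    intro h
    have h1 : a.1 = b.1 := by rw [ea, eb]; simp [h]
    exact hab (Prod.ext h1 (by rw [vertex_snd_eq hXi ha, vertex_snd_eq hXi hb, h1]))
  have hab1 : (-1 : ℝ) ≤ 1 := by norm_num
  have hseg : ∀ {t : ℝ}, c + t • d ∈ segment ℝ a b → -1 ≤ t ∧ t ≤ 1 := by
    intro t ht
    rw [ea, eb, mem_segment_line hab1] at ht
    obtain ⟨s, h1, h2, h3⟩ := ht
    have : t = s := smul_left_injective ℝ hd0 (add_left_cancel h3)
    exact this ▸ ⟨h1, h2⟩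
  have hcs : c ∈ segment ℝ a b := by
    rw [ea, eb, mem_segment_line hab1]
    exact ⟨0, by norm_num, by norm_num, by simp⟩
  have hQ := convex_Gam (f := f) (H := H) (lo := lo) (hi := hi) hXi
  have hcQ := hQ.segment_subset ha.1 hb.1 hcs
  have hcG := Gam_insert_subset hX hcQ
  have haQ := ha.1
  have hbQ := hb.1
  rw [Gam_eq_poly hXi] at haQ hbQ hcQ
  have hsides : ∀ B ∈ constraints f H lo hi (insert x X), ev B c = 0 → B.1 d = 0 := by
    intro B hB h
    have h1 := haQ B hB
    have h2 := hbQ B hB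
    rw [ea, ev_add_smul, h] at h1
    rw [eb, ev_add_smul, h] at h2
    linarith
  have hB : below f H x ∈ constraints f H lo hi (insert x X) :=
    Or.inl ⟨x, Set.mem_insert _ _, rfl⟩
  have hcB : 0 < ev (below f H x) c := by
    refine lt_of_le_of_ne (hcQ _ hB) fun h => hex ?_
    rw [ea, eb]
    intro y hy
    obtain ⟨t, -, -, rfl⟩ := (mem_segment_line hab1).1 hy
    rw [mem_hyperplane_iff, ev_add_smul, ← h, hsides _ hB h.symm]; simp
  have hdt : d ∈ tang (constraints f H lo hi X) c := fun B hB =>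
    hsides B (by rw [constraints_insert]; exact Or.inr hB)
  have hspan : ∀ h ∈ tang (constraints f H lo hi X) c, ∃ s : ℝ, h = s • d := by
    intro h hh
    obtain ⟨t, ht, h1, h2⟩ := exists_pm_mem_poly hfini hcQ
      (mem_tang_constraints_insert hcB.ne' hh)
    rw [← Gam_eq_poly hXi] at h1 h2
    have := hface c hcs _ (Set.insert_subset h1 (Set.singleton_subset_iff.2 h2))
      (isProperConvexComb_pm c (t • h)) (Set.mem_insert _ _)
    rw [ea, eb, mem_segment_line hab1] at this
    obtain ⟨s, -, -, hs⟩ := this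
    refine ⟨t⁻¹ * s, ?_⟩
    rw [mul_smul, ← add_left_cancel hs, smul_smul, inv_mul_cancel₀ ht.ne', one_smul]
  obtain ⟨t₁, t₂, hT⟩ := exists_Icc_of_line hX hd1 hcG
  have hT1 := (hT (-1)).1 (ea ▸ Gam_insert_subset hX ha.1)
  have hT2 := (hT 1).1 (eb ▸ Gam_insert_subset hX hb.1)
  -- By the edge property, two points of the cut polyhedron on the line whose proper combination is
  -- `c` lie in the given segment.
  have hcut' : ∀ t r s : ℝ, c + t • d ∈ Gam f H (insert x X) (box lo hi) →
      c + r • d ∈ Gam f H (insert x X) (box lo hi) → 0 < s → s < 1 → s * t + (1 - s) * r = 0 →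
      -1 ≤ t ∧ t ≤ 1 := by
    intro t r s ht hr hs0 hs1 h
    have h1 := isProperConvexComb_pair (c + t • d) (c + r • d) hs0 hs1
    have e : s • (c + t • d) + (1 - s) • (c + r • d) = c + (s * t + (1 - s) * r) • d := by module
    rw [e, h, zero_smul, add_zero] at h1
    exact hseg (hface c hcs _ (Set.insert_subset ht (Set.singleton_subset_iff.2 hr)) h1
      (Set.mem_insert _ _))
  have hcut : ∀ t : ℝ, t₁ ≤ t → t ≤ t₂ → 0 ≤ ev (below f H x) (c + t • d) →
      -1 ≤ t ∧ t ≤ 1 := by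
    intro t h1 h2 h3
    have htQ : c + t • d ∈ Gam f H (insert x X) (box lo hi) :=
      (mem_Gam_insert hX).2 ⟨(hT t).2 ⟨h1, h2⟩, by rw [ev_below] at h3; linarith⟩
    rcases lt_trichotomy t 0 with h | h | h
    · refine hcut' t 1 (1 / (1 - t)) htQ (eb ▸ hb.1) (by apply div_pos <;> linarith) ?_ ?_
      · rw [div_lt_one] <;> linarith
      · have : 1 - t ≠ 0 := by linarith
        field_simp; ring
    · rw [h]; norm_num
    · refine hcut' t (-1) (1 / (1 + t)) htQ (ea ▸ ha.1) (by apply div_pos <;> linarith) ?_ ?_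
      · rw [div_lt_one] <;> linarith
      · have : 1 + t ≠ 0 := by linarith
        field_simp; ring
  have hedge := edge_of_line hfin (Gam_eq_poly hX ▸ hcG) hdt hspan
    (by simpa only [Gam_eq_poly hX] using hT)
  rw [← Gam_eq_poly hX] at hedge
  have hhyp : hyperplane f H x = {q | ev (below f H x) q = 0} := by
    ext q; exact mem_hyperplane_iff
  have hconvert : ∀ q : Pt m, ev (below f H x) q < 0 → L f H x q.1 < q.2 := fun q h => by
    rw [ev_below] at h; linarith
  have hconvert' : ∀ q : Pt m, 0 ≤ ev (below f H x) q → q.2 ≤ L f H x q.1 := fun q h => by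
    rw [ev_below] at h; linarith
  have hbB : 0 ≤ ev (below f H x) (c + d) := by
    have := hbQ _ hB
    rwa [eb, one_smul] at this
  rcases lt_or_eq_of_le hT1.1 with h1 | h1
  · obtain ⟨p1, -⟩ := ev_cut_end h1 (by linarith) (ea ▸ haQ _ hB)
      (fun t ha hb h => (hcut t ha hb h).1)
    rcases lt_or_eq_of_le hT2.2 with h2 | h2
    -- The other end is treated by reversing `d`. If both ends extended, `ev` would vanish at both
    -- and hence at their midpoint `c`, where it is positive.
    · obtain ⟨p2, -⟩ := ev_cut_end (B := below f H x) (c := c) (d := -d) (t₁ := -t₂)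
        (t₂ := -t₁) (by linarith) (by linarith)
        (by simpa using hbB)
        (fun t ha hb h => by
          have := (hcut (-t) (by linarith) (by linarith) (by simpa using h)).2
          linarith)
      rw [ev_add_smul] at p1 p2
      rw [map_neg] at p2
      linarith
    · subst h2
      obtain ⟨q1, q2, q3⟩ := truncated_line h1 hcB (ea ▸ haQ _ hB)
        (fun t ha hb h => (hcut t ha hb h).1)
      refine Or.inr ⟨_, _, _, segment_symm ℝ (c + t₁ • d) (c + (1 : ℝ) • d) ▸ hedge.2.2,
        hedge.1, hconvert _ q1, hconvert' _ q2, hhyp ▸ q3, ?_⟩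
      rw [ea, eb, segment_symm]
  · subst h1
    rcases lt_or_eq_of_le hT2.2 with h2 | h2
    · obtain ⟨q1, q2, q3⟩ := truncated_line (B := below f H x) (c := c) (d := -d) (t₁ := -t₂)
        (by linarith) hcB (by simpa using hbB)
        (fun t ha hb h => by
          have := (hcut (-t) (by linarith) (by linarith) (by simpa using h)).2
          linarith)
      have e1 : c + (1 : ℝ) • -d = c + (-1 : ℝ) • d := by module
      have e2 : c + (-1 : ℝ) • -d = c + (1 : ℝ) • d := by module
      have e3 : c + (-t₂) • -d = c + t₂ • d := by module
      rw [e1, e2, e3] at q3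
      rw [e1] at q2
      rw [e3] at q1
      exact Or.inr ⟨_, _, _, hedge.2.2, hedge.2.1, hconvert _ q1, hconvert' _ q2, hhyp ▸ q3,
        by rw [ea, eb]⟩
    · left
      subst h2
      rw [ea, eb]
      exact hedge.2.2

end Subgraph

/-! ### Recovering endpoints from edges stored as point sets. -/

section Segments

variable {m : ℕ}

theorem left_mem_extremePoints_segment (u v : Pt m) :
    u ∈ (segment ℝ u v).extremePoints ℝ := by
  have hpar : ∀ y : Pt m, y ∈ segment ℝ u v ↔ ∃ t : ℝ, 0 ≤ t ∧ t ≤ 1 ∧ y = u + t • (v - u) := by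
    intro y
    have := mem_segment_line (c := u) (d := v - u) (y := y) (zero_le_one (α := ℝ))
    rwa [zero_smul, add_zero, one_smul, add_sub_cancel] at this
  refine ⟨left_mem_segment ℝ u v, fun x hx y hy hu => ?_⟩
  obtain ⟨s, hs, -, rfl⟩ := (hpar x).1 hx
  obtain ⟨t, ht, -, rfl⟩ := (hpar y).1 hy
  obtain ⟨α, β, hα, hβ, hαβ, h⟩ := hu
  have e : α • (u + s • (v - u)) + β • (u + t • (v - u)) =
      (α + β) • u + (α * s + β * t) • (v - u) := by module
  rw [e, hαβ, one_smul, add_eq_left, smul_eq_zero] at h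
  rcases h with h | h
  · have hs0 : s = 0 := by
      have := mul_nonneg hβ.le ht
      have h' : α * s = 0 := le_antisymm (by linarith) (mul_nonneg hα.le hs)
      exact (mul_eq_zero.1 h').resolve_left hα.ne'
    simp [hs0]
  · simp [h]

/-- The endpoints of a segment are its extreme points. This is needed because `Eminus` and `Eplus`
quantify over all representations of an edge. -/
theorem left_eq_of_segment_eq {u v p q : Pt m} (h : segment ℝ u v = segment ℝ p q) :
    u = p ∨ u = q := by
  have h1 := left_mem_extremePoints_segment u v
  rw [h, ← convexHull_pair] at h1
  have h2 : u ∈ ({p, q} : Set (Pt m)) := extremePoints_convexHull_subset h1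
  exact h2

theorem segment_ne_downRay (u v w : Pt m) : segment ℝ u v ≠ downRay w := by
  intro h
  have h1 : ((w.1, min w.2 (min u.2 v.2 - 1)) : Pt m) ∈ segment ℝ u v := by
    rw [h]; exact ⟨rfl, min_le_left _ _⟩
  obtain ⟨α, β, hα, hβ, hαβ, he⟩ := h1
  have h2 : α * u.2 + β * v.2 = min w.2 (min u.2 v.2 - 1) := congrArg Prod.snd he
  have h3 := min_le_right w.2 (min u.2 v.2 - 1)
  have h4 := mul_le_mul_of_nonneg_left (min_le_left u.2 v.2) hα
  have h5 := mul_le_mul_of_nonneg_left (min_le_right u.2 v.2) hβ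
  have h6 : α * min u.2 v.2 + β * min u.2 v.2 = min u.2 v.2 := by rw [← add_mul, hαβ, one_mul]
  linarith

theorem vertices_convexHull_subset (V : Set (Pt m)) : vertices (convexHull ℝ V) ⊆ V := by
  intro v hv
  refine extremePoints_convexHull_subset (𝕜 := ℝ) ⟨hv.1, fun x hx y hy h => ?_⟩
  obtain ⟨s, t, hs, ht, hst, rfl⟩ := h
  obtain rfl : t = 1 - s := by linarith
  have h1 := hv.2 {x, y} (Set.insert_subset hx (Set.singleton_subset_iff.2 hy))
    (isProperConvexComb_pair x y hs (by linarith))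
  exact (h1 ▸ Set.mem_insert x {y} :)

end Segments

/-! ### One cut preserves the covering property. -/

section Cut

variable {m n : ℕ} {f : Label n → ℝ} {H : Label n → Fin m → ℝ} {lo hi : Fin m → ℝ}

/-- What the loop preserves: the points and edges that are stored lie in `Γ_X`, and among them are
all the vertices and edges of `Γ_X`. -/
structure Covers (f : Label n → ℝ) (H : Label n → Fin m → ℝ) (lo hi : Fin m → ℝ)
    (X : Set (Label n)) (V : Set (Pt m)) (E : Set (Set (Pt m))) : Prop where
  subset_Gam : V ⊆ Gam f H X (box lo hi)
  vertices_subset : vertices (Gam f H X (box lo hi)) ⊆ V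
  ends : ∀ e ∈ E, (∃ u ∈ V, ∃ v ∈ V, e = segment ℝ u v) ∨ ∃ u ∈ V, e = downRay u
  skeletonEdges_subset : skeletonEdges f H lo hi X ⊆ E

theorem exists_mem_Vminus_of_mem_Eminus {V : Set (Pt m)} {E : Set (Set (Pt m))} {x : Label n}
    {e : Set (Pt m)} (he : e ∈ Eminus f H V E x) : ∃ u ∈ e, u ∈ Vminus f H V x := by
  obtain ⟨-, ⟨u₁, u₂, rfl, h | h⟩ | ⟨u, h, rfl⟩⟩ := he
  · exact ⟨u₁, left_mem_segment ℝ _ _, h⟩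
  · exact ⟨u₂, right_mem_segment ℝ _ _, h⟩
  · exact ⟨u, ⟨rfl, le_rfl⟩, h⟩

theorem not_subset_hyperplane_of_mem_Eminus {V : Set (Pt m)} {E : Set (Set (Pt m))} {x : Label n}
    {e : Set (Pt m)} (he : e ∈ Eminus f H V E x) : ¬ e ⊆ hyperplane f H x := by
  obtain ⟨u, hu, -, hlt⟩ := exists_mem_Vminus_of_mem_Eminus he
  intro h
  exact hlt.ne' (h hu)

theorem Covers.edge_subset {X : Set (Label n)} {V : Set (Pt m)} {E : Set (Set (Pt m))}
    (h : Covers f H lo hi X V E) (hX : X.Nonempty) {e : Set (Pt m)} (he : e ∈ E) :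
    e ⊆ Gam f H X (box lo hi) := by
  rcases h.ends e he with ⟨u, hu, v, hv, rfl⟩ | ⟨u, hu, rfl⟩
  · exact (convex_Gam hX).segment_subset (h.subset_Gam hu) (h.subset_Gam hv)
  · exact downRay_subset_Gam (h.subset_Gam hu)

theorem Covers.Vplus_subset {X : Set (Label n)} {V : Set (Pt m)} {E : Set (Set (Pt m))}
    (h : Covers f H lo hi X V E) (hX : X.Nonempty) (x : Label n) :
    Vplus f H E x ⊆ Gam f H (insert x X) (box lo hi) := by
  rintro u ⟨e, he, -, hux, hue⟩
  exact (mem_Gam_insert hX).2 ⟨h.edge_subset hX he hue, le_of_eq hux⟩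

theorem Covers.vertex_mem_Vplus {X : Set (Label n)} {V : Set (Pt m)} {E : Set (Set (Pt m))}
    (h : Covers f H lo hi X V E) (hX : X.Nonempty) (hlo : ∀ i, lo i ≤ hi i) {x : Label n}
    {v : Pt m} (hv : v ∈ V) (hvx : L f H x v.1 < v.2) {u : Pt m}
    (hu : u ∈ vertices (Gam f H (insert x X) (box lo hi))) (hux : u ∈ hyperplane f H x) :
    u ∈ Vplus f H E x := by
  obtain ⟨e, he, hue, hex⟩ := exists_edge_through hX hlo hu hux (h.subset_Gam hv)
    (fun hv' => hvx.ne' hv')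
  exact ⟨e, h.skeletonEdges_subset he, hex, hux, hue⟩

/-- The vertices stored after the cut by `x`. -/
def cutV (f : Label n → ℝ) (H : Label n → Fin m → ℝ) (V : Set (Pt m)) (E : Set (Set (Pt m)))
    (x : Label n) : Set (Pt m) :=
  {u | u ∈ V ∧ u.2 ≤ L f H x u.1} ∪ Vplus f H E x

theorem mem_cutV {V : Set (Pt m)} {E : Set (Set (Pt m))} {x : Label n} {u : Pt m} (hu : u ∈ V)
    (hux : u ∉ Vminus f H V x) : u ∈ cutV f H V E x :=
  Or.inl ⟨hu, not_lt.1 fun h => hux ⟨hu, h⟩⟩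

/-- The edges stored after the cut by `x`. -/
def cutE (f : Label n → ℝ) (H : Label n → Fin m → ℝ) (V : Set (Pt m)) (E : Set (Set (Pt m)))
    (x : Label n) : Set (Set (Pt m)) :=
  (E ∪ convEdge (Vplus f H E x) ∪ Eplus f H V E x) \ Eminus f H V E x

theorem Covers.cut_ends {X : Set (Label n)} {V : Set (Pt m)} {E : Set (Set (Pt m))}
    (h : Covers f H lo hi X V E) {x : Label n} {e : Set (Pt m)} (he : e ∈ cutE f H V E x) :
    (∃ u ∈ cutV f H V E x, ∃ v ∈ cutV f H V E x, e = segment ℝ u v) ∨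
      ∃ u ∈ cutV f H V E x, e = downRay u := by
  obtain ⟨(he | he) | he, hem⟩ := he
  · rcases h.ends e he with ⟨u, hu, v, hv, rfl⟩ | ⟨u, hu, rfl⟩
    · exact Or.inl ⟨u, mem_cutV hu fun hu' => hem ⟨he, Or.inl ⟨u, v, rfl, Or.inl hu'⟩⟩,
        v, mem_cutV hv fun hv' => hem ⟨he, Or.inl ⟨u, v, rfl, Or.inr hv'⟩⟩, rfl⟩
    · exact Or.inr ⟨u, mem_cutV hu fun hu' => hem ⟨he, Or.inr ⟨u, hu', rfl⟩⟩, rfl⟩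
  · obtain ⟨u, hu, v, hv, rfl, -⟩ := he
    exact Or.inl ⟨u, Or.inr (vertices_convexHull_subset _ hu), v,
      Or.inr (vertices_convexHull_subset _ hv), rfl⟩
  · rcases he with ⟨u₁, u₂, u₃, hm, hu₁, h₃, rfl⟩ | ⟨u₂, u₃, hm, h₃, rfl⟩
    · have hu₃ : u₃ ∈ segment ℝ u₁ u₂ ∩ hyperplane f H x := by rw [h₃]; rfl
      -- `Eplus` only says that `u₁` is not removed; that it is a stored point at all comes from
      -- `h.ends`.
      have hu₁V : u₁ ∈ V := by
        rcases h.ends _ hm.1 with ⟨p, hp, q, hq, hpq⟩ | ⟨p, -, hpq⟩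
        · rcases left_eq_of_segment_eq hpq with rfl | rfl
          · exact hp
          · exact hq
        · exact (segment_ne_downRay _ _ _ hpq).elim
      exact Or.inl ⟨u₁, mem_cutV hu₁V hu₁, u₃, Or.inr ⟨_, hm.1,
        not_subset_hyperplane_of_mem_Eminus hm, hu₃.2, hu₃.1⟩, rfl⟩
    · have hu₃ : u₃ ∈ downRay u₂ ∩ hyperplane f H x := by rw [h₃]; rfl
      exact Or.inr ⟨u₃, Or.inr ⟨_, hm.1,
        not_subset_hyperplane_of_mem_Eminus hm, hu₃.2, hu₃.1⟩, rfl⟩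

theorem not_mem_Eminus_of_subset {X : Set (Label n)} (hX : X.Nonempty) {V : Set (Pt m)}
    {E : Set (Set (Pt m))} {x : Label n} {e : Set (Pt m)}
    (he : e ⊆ Gam f H (insert x X) (box lo hi)) : e ∉ Eminus f H V E x := by
  intro hm
  obtain ⟨u, hu, -, hlt⟩ := exists_mem_Vminus_of_mem_Eminus hm
  exact hlt.not_ge ((mem_Gam_insert hX).1 (he hu)).2

/-- For an edge inside `P_x`, both ends are in `𝒱⁺`, whose hull lies in the new polyhedron; being a
vertex or an edge passes to a smaller set containing the ends. -/
theorem Covers.cut_edges {X : Set (Label n)} {V : Set (Pt m)} {E : Set (Set (Pt m))}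
    (h : Covers f H lo hi X V E) (hX : X.Nonempty) (hlo : ∀ i, lo i ≤ hi i) {x : Label n}
    {v : Pt m} (hv : v ∈ V) (hvx : L f H x v.1 < v.2) :
    edges (Gam f H (insert x X) (box lo hi)) ⊆ cutE f H V E x := by
  intro e he
  have hsub : e ⊆ Gam f H (insert x X) (box lo hi) := by
    obtain ⟨a, ha, b, hb, rfl, -⟩ := he
    exact (convex_Gam (Set.insert_nonempty _ _)).segment_subset ha.1 hb.1
  refine ⟨?_, not_mem_Eminus_of_subset hX hsub⟩
  by_cases hex : e ⊆ hyperplane f H x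
  · left; right
    obtain ⟨a, ha, b, hb, rfl, hface⟩ := he
    have haV := h.vertex_mem_Vplus hX hlo hv hvx ha (hex (left_mem_segment ℝ _ _))
    have hbV := h.vertex_mem_Vplus hX hlo hv hvx hb (hex (right_mem_segment ℝ _ _))
    have hconv : convexHull ℝ (Vplus f H E x) ⊆ Gam f H (insert x X) (box lo hi) :=
      convexHull_min (h.Vplus_subset hX x) (convex_Gam (Set.insert_nonempty _ _))
    exact ⟨a, vertices_mono hconv (subset_convexHull ℝ _ haV) ha,
      b, vertices_mono hconv (subset_convexHull ℝ _ hbV) hb, rfl,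
      fun y hy W hW => hface y hy W (hW.trans hconv)⟩
  · rcases edge_of_edge_cut hX he hex with he' | ⟨u₁, u₂, u₃, h12, hu₂, hlt, hle, h₃, rfl⟩
    · exact Or.inl (Or.inl (h.skeletonEdges_subset (Or.inl he')))
    · exact Or.inr (Or.inl ⟨u₁, u₂, u₃, ⟨h.skeletonEdges_subset (Or.inl h12),
        Or.inl ⟨u₁, u₂, rfl, Or.inr ⟨h.vertices_subset hu₂, hlt⟩⟩⟩,
        fun hm => hm.2.not_ge hle, h₃, rfl⟩)

/-- A corner vertex that is new lies on `P_x`, strictly below the old vertex over the same corner,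
and its ray is the old ray truncated. -/
theorem Covers.cut_rays {X : Set (Label n)} {V : Set (Pt m)} {E : Set (Set (Pt m))}
    (h : Covers f H lo hi X V E) (hX : X.Nonempty) (hlo : ∀ i, lo i ≤ hi i) {x : Label n}
    {u : Pt m} (hu : u ∈ vertices (Gam f H (insert x X) (box lo hi)))
    (hcor : u.1 ∈ corners lo hi) : downRay u ∈ cutE f H V E x := by
  refine ⟨?_, not_mem_Eminus_of_subset hX (downRay_subset_Gam hu.1)⟩
  by_cases huv : u ∈ vertices (Gam f H X (box lo hi))
  · exact Or.inl (Or.inl (h.skeletonEdges_subset (Or.inr ⟨u, huv, hcor, rfl⟩)))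
  have hux : u ∈ hyperplane f H x := by
    by_contra hcon
    exact huv (vertex_of_vertex_cut hX hu hcon)
  have huG := Gam_insert_subset hX hu.1
  have hw := corner_mem_vertices (f := f) (H := H) hX hlo hcor
  have hlt : L f H x u.1 < inducedDual f H X u.1 := by
    refine lt_of_le_of_ne ?_ fun he => huv ?_
    · rw [← show u.2 = L f H x u.1 from hux]; exact huG.2
    · have : u = (u.1, inducedDual f H X u.1) := Prod.ext rfl ((show u.2 = _ from hux).trans he)
      rw [this]; exact hw
  refine Or.inr (Or.inr ⟨(u.1, inducedDual f H X u.1), u,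
    ⟨h.skeletonEdges_subset (Or.inr ⟨_, hw, hcor, rfl⟩),
      Or.inr ⟨_, ⟨h.vertices_subset hw, hlt⟩, rfl⟩⟩, ?_, rfl⟩)
  refine Set.eq_singleton_iff_unique_mem.2 ⟨⟨⟨rfl, huG.2⟩, hux⟩, fun q hq => ?_⟩
  have h1 : q.1 = u.1 := hq.1.1
  have h2 : q.2 = L f H x q.1 := hq.2
  exact Prod.ext h1 (by rw [h2, h1]; exact (show u.2 = _ from hux).symm)

theorem Covers.cut {X : Set (Label n)} {V : Set (Pt m)} {E : Set (Set (Pt m))}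
    (h : Covers f H lo hi X V E) (hX : X.Nonempty) (hlo : ∀ i, lo i ≤ hi i) {x : Label n}
    {v : Pt m} (hv : v ∈ V) (hvx : L f H x v.1 < v.2) :
    Covers f H lo hi (insert x X) (cutV f H V E x) (cutE f H V E x) where
  subset_Gam := by
    rintro u (hu | hu)
    · exact (mem_Gam_insert hX).2 ⟨h.subset_Gam hu.1, hu.2⟩
    · exact h.Vplus_subset hX x hu
  vertices_subset := by
    intro u hu
    by_cases hux : u ∈ hyperplane f H x
    · exact Or.inr (h.vertex_mem_Vplus hX hlo hv hvx hu hux)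
    · exact Or.inl ⟨h.vertices_subset (vertex_of_vertex_cut hX hu hux),
        ((mem_Gam_insert hX).1 hu.1).2⟩
  ends := fun _ he => h.cut_ends he
  skeletonEdges_subset := by
    rintro e (he | ⟨u, hu, hcor, rfl⟩)
    · exact h.cut_edges hX hlo hv hvx he
    · exact h.cut_rays hX hlo hu hcor

end Cut

/-! ### The invariant along a run. -/

section Run

variable {m n : ℕ} {f : Label n → ℝ} {H : Label n → Fin m → ℝ} {lo hi : Fin m → ℝ}
  {O : (Fin m → ℝ) → Label n}

/-- The loop invariant. -/
structure Invariant (f : Label n → ℝ) (H : Label n → Fin m → ℝ) (lo hi : Fin m → ℝ)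
    (O : (Fin m → ℝ) → Label n) (s : State m n) : Prop where
  nonempty : s.X.Nonempty
  subset_charSet : s.X ⊆ charSet f H (box lo hi)
  covers : Covers f H lo hi s.X s.V s.E
  visited_le : ∀ v ∈ s.visited, v.2 ≤ L f H (O v.1) v.1

theorem corners_subset_box (hlo : ∀ i, lo i ≤ hi i) : corners lo hi ⊆ box lo hi := by
  intro lam h i
  rcases h i with h | h <;> simp [h, hlo i]

theorem mem_charSet {S : Set (Fin m → ℝ)} (hO : ∀ lam ∈ S, O lam ∈ argmin f H lam)
    {lam : Fin m → ℝ} (h : lam ∈ S) : O lam ∈ charSet f H S :=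
  Set.mem_biUnion h (hO lam h)

theorem Invariant.init (hlo : ∀ i, lo i ≤ hi i)
    (hO : ∀ lam ∈ box lo hi, O lam ∈ argmin f H lam) {s : State m n}
    (hs : IsInit f H lo hi O s) : Invariant f H lo hi O s := by
  obtain ⟨lam₀, hlam₀, hX, hvis, -, hpend, hE⟩ := hs
  have hV : ∀ u, u ∈ s.V ↔ u.1 ∈ corners lo hi ∧ u.2 = L f H (O lam₀) u.1 := fun u => by
    simp [State.V, hvis, hpend]
  have hvert : vertices (Gam f H s.X (box lo hi)) ⊆ s.V := fun v hv => by
    rw [hX] at hv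
    exact (hV v).2 (vertices_Gam_singleton hv)
  refine ⟨hX ▸ Set.singleton_nonempty _, ?_, ⟨?_, hvert, ?_, hE.ge⟩, by simp [hvis]⟩
  · rw [hX, Set.singleton_subset_iff]
    exact mem_charSet hO (corners_subset_box hlo hlam₀)
  · intro u hu
    obtain ⟨h1, h2⟩ := (hV u).1 hu
    rw [hX, mem_Gam_iff (Set.singleton_nonempty _)]
    exact ⟨corners_subset_box hlo h1, by simp [h2]⟩
  · rw [hE]
    rintro e (⟨u, hu, v, hv, rfl, -⟩ | ⟨u, hu, -, rfl⟩)
    · exact Or.inl ⟨u, hvert hu, v, hvert hv, rfl⟩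
    · exact Or.inr ⟨u, hvert hu, rfl⟩

theorem Invariant.step (hlo : ∀ i, lo i ≤ hi i)
    (hO : ∀ lam ∈ box lo hi, O lam ∈ argmin f H lam) {s t : State m n}
    (hs : Invariant f H lo hi O s) (hst : Step f H O s t) : Invariant f H lo hi O t := by
  cases hst with
  | confirm v rest hv hz =>
    refine ⟨hs.nonempty, hs.subset_charSet, ?_, ?_⟩
    · have : (⟨s.X, s.visited ++ [v], rest, s.E⟩ : State m n).V = s.V := by
        ext u
        simp only [State.V, hv, Set.mem_ofPred_eq, List.mem_append, List.mem_cons,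
          List.not_mem_nil, or_false, or_assoc]
      rw [this]
      exact hs.covers
    · intro u hu
      simp only [List.mem_append, List.mem_singleton] at hu
      rcases hu with hu | rfl
      · exact hs.visited_le u hu
      · exact not_lt.1 hz
  | cut v rest new hv hz hnodup hnew =>
    have hvV : v ∈ s.V := Or.inr (by simp [hv])
    refine ⟨Set.insert_nonempty _ _, Set.insert_subset
      (mem_charSet hO (hs.covers.subset_Gam hvV).1) hs.subset_charSet, ?_, ?_⟩
    · have := hs.covers.cut hs.nonempty hlo hvV hz
      refine Eq.subst (motive := fun V => Covers f H lo hi _ V _) ?_ this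
      ext u
      have hplus : u ∈ Vplus f H s.E (O v.1) → u.2 ≤ L f H (O v.1) u.1 := by
        rintro ⟨e, -, -, hu, -⟩
        exact le_of_eq hu
      -- The list update drops the head `v` outright, which agrees with `cutV` because `v` itself
      -- lies above the cut.
      have hvu : u = v → ¬ u.2 ≤ L f H (O v.1) u.1 := by
        rintro rfl; exact not_le.2 hz
      simp only [cutV, State.V, hv, Set.mem_ofPred_eq, Set.mem_union, List.mem_append,
        List.mem_cons, List.mem_filter, decide_eq_true_eq, hnew]
      tauto
    · intro u hu
      exact hs.visited_le u (List.mem_of_mem_filter hu)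

end Run

/-! ### From confirmed vertices to optimality, and the facet case. -/

section Optimality

variable {m n : ℕ} {f : Label n → ℝ} {H : Label n → Fin m → ℝ} {lo hi : Fin m → ℝ}

theorem continuous_L (x : Label n) : Continuous (L f H x) := by
  unfold L; fun_prop

theorem isCompact_box : IsCompact (box lo hi) := by
  have : box lo hi = Set.Icc lo hi := by
    ext lam
    simp only [box, Set.mem_ofPred_eq, Set.mem_Icc, Pi.le_def, forall_and]
  rw [this]
  exact isCompact_Icc

theorem isCompact_Gam_inter {X : Set (Label n)} (hX : X.Nonempty) (y : Label n) :
    IsCompact {q | q ∈ Gam f H X (box lo hi) ∧ L f H y q.1 ≤ q.2} := by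
  obtain ⟨x, hx⟩ := hX
  obtain ⟨a, ha⟩ := isCompact_box.bddBelow_image (continuous_L (f := f) (H := H) y).continuousOn
    (K := box lo hi)
  obtain ⟨b, hb⟩ := isCompact_box.bddAbove_image (continuous_L (f := f) (H := H) x).continuousOn
    (K := box lo hi)
  refine ((isCompact_box (lo := lo) (hi := hi)).prod (isCompact_Icc (a := a) (b := b))).of_isClosed_subset ?_ ?_
  · have : {q | q ∈ Gam f H X (box lo hi) ∧ L f H y q.1 ≤ q.2} =
        (Prod.fst ⁻¹' box lo hi ∩ ⋂ x ∈ X, {q : Pt m | q.2 ≤ L f H x q.1}) ∩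
          {q | L f H y q.1 ≤ q.2} := by
      ext q
      simp [mem_Gam_iff ⟨x, hx⟩]
    rw [this]
    have hc : ∀ x, Continuous fun q : Pt m => L f H x q.1 := fun x =>
      (continuous_L x).comp continuous_fst
    exact ((isCompact_box.isClosed.preimage continuous_fst).inter
      (isClosed_biInter fun x _ => isClosed_le continuous_snd (hc x))).inter
      (isClosed_le (hc y) continuous_snd)
  · rintro q ⟨hq, hqy⟩
    exact ⟨hq.1, (ha ⟨_, hq.1, rfl⟩).trans hqy,
      (hq.2.trans (inducedDual_le hx _)).trans (hb ⟨_, hq.1, rfl⟩)⟩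

/-- `Γ_X` is unbounded only downwards, so its part above `P_y` is compact. An extreme point of the
set of minimizers of `L(y,λ) - z` is a vertex of all of `Γ_X`: if `v ± t • d` stay in `Γ_X`, both
are again minimizers, so `d = 0`. -/
theorem exists_vertex_above {X : Set (Label n)} (hX : X.Nonempty) {y : Label n} {q : Pt m}
    (hq : q ∈ Gam f H X (box lo hi)) (hqy : L f H y q.1 < q.2) :
    ∃ v ∈ vertices (Gam f H X (box lo hi)), L f H y v.1 < v.2 := by
  have hcont : Continuous (ev (below f H y)) := by
    have : ev (below f H y) = fun q => L f H y q.1 - q.2 := funext (ev_below f H y)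
    rw [this]
    exact ((continuous_L y).comp continuous_fst).sub continuous_snd
  have hK := isCompact_Gam_inter (f := f) (H := H) (lo := lo) (hi := hi) hX y
  obtain ⟨p, hp, hmin⟩ := hK.exists_isMinOn ⟨q, hq, hqy.le⟩ hcont.continuousOn
  have hpq : ev (below f H y) p < 0 := by
    have h1 : ev (below f H y) p ≤ ev (below f H y) q := hmin ⟨hq, hqy.le⟩
    rw [ev_below _ _ _ q] at h1
    linarith
  have hall : ∀ r ∈ Gam f H X (box lo hi), ev (below f H y) p ≤ ev (below f H y) r := by
    intro r hr
    rcases le_total (L f H y r.1) r.2 with h | h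
    · exact hmin ⟨hr, h⟩
    · rw [ev_below _ _ _ r]
      linarith
  obtain ⟨v, ⟨⟨hvK, hvp⟩, hext⟩⟩ := (hK.inter_right
    (isClosed_eq hcont (continuous_const (y := ev (below f H y) p)))).extremePoints_nonempty
    ⟨p, hp, rfl⟩
  have hvp : ev (below f H y) v = ev (below f H y) p := hvp
  refine ⟨v, (mem_vertices_Gam hX).2 ⟨hvK.1, fun d hd => ?_⟩, ?_⟩
  · obtain ⟨t, ht, h1, h2⟩ := exists_pm_mem_poly (constraints_finite f H lo hi X)
      (Gam_eq_poly hX ▸ hvK.1) hd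
    rw [← Gam_eq_poly hX] at h1 h2
    have e2 : v - t • d = v + (-t) • d := by module
    have h3 := hall _ h1
    have h4 := hall _ h2
    rw [ev_add_smul, hvp] at h3
    rw [e2, ev_add_smul, hvp] at h4
    have h5 : ev (below f H y) (v + t • d) = ev (below f H y) p := by
      rw [ev_add_smul, hvp]; linarith
    have h6 : ev (below f H y) (v - t • d) = ev (below f H y) p := by
      rw [e2, ev_add_smul, hvp]; linarith
    have mem : ∀ r ∈ Gam f H X (box lo hi), ev (below f H y) r = ev (below f H y) p →
        r ∈ {q | q ∈ Gam f H X (box lo hi) ∧ L f H y q.1 ≤ q.2} ∩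
          {r | ev (below f H y) r = ev (below f H y) p} := fun r hr he =>
      ⟨⟨hr, by have := ev_below f H y r; linarith⟩, he⟩
    have := hext (mem _ h1 h5) (mem _ h2 h6)
      ⟨1 / 2, 1 / 2, by norm_num, by norm_num, by norm_num, by module⟩
    simpa [ht.ne'] using this
  · have := ev_below f H y v
    linarith

theorem inducedDual_eq_dual {X : Set (Label n)} (hX : X.Nonempty)
    (h : ∀ v ∈ vertices (Gam f H X (box lo hi)), ∀ y, v.2 ≤ L f H y v.1) {lam : Fin m → ℝ}
    (hlam : lam ∈ box lo hi) : inducedDual f H X lam = dual f H lam := by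
  refine le_antisymm ((le_inducedDual_iff Set.univ_nonempty).2 fun y _ => ?_)
    ((le_inducedDual_iff hX).2 fun x _ => inducedDual_le (Set.mem_univ x) lam)
  by_contra hcon
  obtain ⟨v, hv, hlt⟩ := exists_vertex_above (q := (lam, inducedDual f H X lam)) hX ⟨hlam, le_rfl⟩
    (not_le.1 hcon)
  exact hlt.not_ge (h v hv y)

theorem L_eq_of_interior_nonempty {x y : Label n}
    (h : (interior {lam | L f H y lam = L f H x lam}).Nonempty) : L f H y = L f H x := by
  obtain ⟨p, hp⟩ := h
  funext lam
  have hcont : Tendsto (fun t : ℝ => p + t • (lam - p)) (𝓝[>] 0) (𝓝 p) := by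
    have : Tendsto (fun t : ℝ => p + t • (lam - p)) (𝓝 0) (𝓝 (p + (0 : ℝ) • (lam - p))) :=
      (by fun_prop : Continuous fun t : ℝ => p + t • (lam - p)).tendsto 0
    rw [zero_smul, add_zero] at this
    exact this.mono_left nhdsWithin_le_nhds
  obtain ⟨t, h1, ht⟩ := ((hcont.eventually (mem_interior_iff_mem_nhds.1 hp)).and
    self_mem_nhdsWithin).exists
  have ht : 0 < t := ht
  have h1 : L f H y (p + t • (lam - p)) = L f H x (p + t • (lam - p)) := h1
  have h2 : L f H y p = L f H x p :=
    interior_subset (s := {lam | L f H y lam = L f H x lam}) hp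
  have haff : ∀ x, L f H x (p + t • (lam - p)) = L f H x p + t * (L f H x lam - L f H x p) := by
    intro x
    simp only [L, Pi.add_apply, Pi.smul_apply, Pi.sub_apply, smul_eq_mul, add_mul,
      Finset.sum_add_distrib, mul_assoc, ← Finset.mul_sum, sub_mul, Finset.sum_sub_distrib]
    ring
  rw [haff, haff, h2] at h1
  have := mul_left_cancel₀ ht.ne' (add_left_cancel h1)
  linarith

/-- On the open facet of `x`, each point has some `y ∈ X` with `L(y,·) = L(x,·)` there. Finitely
many closed sets cover the facet, so one has interior; two affine functions agreeing on an open set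
are equal, and distinct elements have distinct hyperplanes. -/
theorem charSet_subset_of_facets {X : Set (Label n)} {S : Set (Fin m → ℝ)} (hX : X.Nonempty)
    (hXS : X ⊆ charSet f H S) (hdual : ∀ lam ∈ S, inducedDual f H X lam = dual f H lam)
    (hfacet : FacetCorrespondence f H S) : charSet f H S ⊆ X := by
  intro x hx
  have hne := hfacet.1 x hx
  have hex : ∃ y ∈ X, (interior {lam | L f H y lam = L f H x lam}).Nonempty := by
    by_contra! hcon
    have hdense : Dense (⋂ y ∈ X, {lam | L f H y lam = L f H x lam}ᶜ) :=
      dense_biInter_of_isOpen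
        (fun y _ => (isClosed_eq (continuous_L y) (continuous_L x)).isOpen_compl)
        X.to_countable (fun y hy => interior_eq_empty_iff_dense_compl.1 (hcon y hy))
    obtain ⟨lam, h1, h2⟩ := hdense.inter_open_nonempty _ isOpen_interior hne
    obtain ⟨hS, he⟩ := interior_subset h1
    obtain ⟨y, hy, hye⟩ := exists_inducedDual_eq (f := f) (H := H) hX lam
    exact Set.mem_iInter₂.1 h2 y hy (hye.trans ((hdual lam hS).trans he.symm))
  obtain ⟨y, hy, hint⟩ := hex
  have hL := L_eq_of_interior_nonempty hint
  have : y = x := hfacet.2 (hXS hy) hx (by simp only [hyperplane, hL])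
  exact this ▸ hy

end Optimality

end DualSearch

theorem mainTheorem1 (m n : ℕ) (f : DualSearch.Label n → ℝ) (H : DualSearch.Label n → Fin m → ℝ)
    (lo hi : Fin m → ℝ) (hbox : ∀ i, lo i < hi i)
    (O : (Fin m → ℝ) → DualSearch.Label n)
    (hO : ∀ lam ∈ DualSearch.box lo hi, O lam ∈ DualSearch.argmin f H lam)
    (X : Set (DualSearch.Label n))
    (hX : DualSearch.TerminatesWith f H lo hi O X) :
    X ⊆ DualSearch.charSet f H (DualSearch.box lo hi) ∧
    (∀ lam ∈ DualSearch.box lo hi,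
      DualSearch.inducedDual f H X lam = DualSearch.dual f H lam) ∧
    (∀ x ∈ X, ∀ y, H y = H x → f x ≤ f y) ∧
    (DualSearch.FacetCorrespondence f H (DualSearch.box lo hi) →
      X = DualSearch.charSet f H (DualSearch.box lo hi)) := by
  obtain ⟨s₀, s, hinit, hrun, hend, rfl⟩ := hX
  have hlo : ∀ i, lo i ≤ hi i := fun i => (hbox i).le
  have hs : DualSearch.Invariant f H lo hi O s := by
    clear hend
    induction hrun with
    | refl => exact .init hlo hO hinit
    | tail _ hstep ih => exact ih.step hlo hO hstep
  have hdual : ∀ lam ∈ DualSearch.box lo hi,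
      DualSearch.inducedDual f H s.X lam = DualSearch.dual f H lam := by
    intro lam hlam
    refine DualSearch.inducedDual_eq_dual hs.nonempty (fun v hv y => ?_) hlam
    have hvis : v ∈ s.visited := (hs.covers.vertices_subset hv).resolve_right (by simp [hend])
    exact (hs.visited_le v hvis).trans (hO v.1 hv.1.1 y)
  refine ⟨hs.subset_charSet, hdual, fun x hx y hyx => ?_, fun hfacet =>
    hs.subset_charSet.antisymm
      (DualSearch.charSet_subset_of_facets hs.nonempty hs.subset_charSet hdual hfacet)⟩
  -- At a multiplier where `x` minimizes the Lagrangian, the terms `λᵀH` cancel for `y` with `H y =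
  -- H x`.
  obtain ⟨lam, -, hlam⟩ := Set.mem_iUnion₂.1 (hs.subset_charSet hx)
  have := hlam y
  simp only [DualSearch.L, hyx] at this
  linarith
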